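/- Let $A,C,Q\in\mathbb R^{n\times n}$, $B,D\in\mathbb R^{n\times m_1}$, $G\in\mathbb R^{n\times m_2}$, $R\in\mathbb R^{m_1\times m_1}$ with $Q=Q^\top\ge 0$, $R=R^\top>0$, and let $\gamma>0$. For $K\in\mathbb R^{m_1\times n}$, $L\in\mathbb R^{m_2\times n}$ and symmetric $P$ put $$\mathscr L_{K,L}(P)=(A-BK+GL)^\top P+P(A-BK+GL)+(C-DK)^\top P(C-DK),$$ $$\mathscr K^1(P)=(R+D^\top PD)^{-1}(B^\top P+D^\top PC),\qquad \mathscr K^2(P)=\gamma^{-2}G^\top P .$$ Call $(K,L)$ stabilizing if all eigenvalues of $\mathscr L_{K,L}$ on the (complexified) symmetric matrices lie in the open left half-plane. Assume that $[A,B|C,D]$ is stabilizable (for some $K$, every solution of $dx=(A-BK)x\,dt+(C-DK)x\,dw$ tends to $0$ in mean square) and that $[A,Q|C]$ is exactly detectable (every solution of $dx=Ax\,dt+Cx\,dw$ with $Qx\equiv 0$ almost surely tends to $0$ in mean square), and let $P^*\ge 0$ be the stabilizing solution of $$A^\top P+PA+C^\top PC+Q+\gamma^{-2}PGG^\top P-(PB+C^\top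 PD)(R+D^\top PD)^{-1}(B^\top P+D^\top PC)=0,$$ that is, $(\mathscr K^1(P^*),\mathscr K^2(P^*))$ is stabilizing. Outer loop: $P^0=0$, $L_p^{k}=\mathscr K^2(P^{k})$ for $k\ge 0$, and for $k\ge 1$, $P^{k}\ge 0$ is the stabilizing solution (i.e. $(K_p^k,L_p^{k-1})$ is stabilizing) of $$\mathscr L_{K_p^{k},L_p^{k-1}}(P^{k})+Q-\gamma^2 (L_p^{k-1})^\top L_p^{k-1}+(K_p^{k})^\top RK_p^{k}=0,\qquad K_p^{k}=\mathscr K^1(P^{k}).$$ Inner loop for fixed $k\ge 1$, started from some $K_p^{(k,0)}$: for $j\ge 1$, $P^{(k,j)}$ is a symmetric solution of $$\mathscr L_{K_p^{(k,j-1)},L_p^{k-1}}(P^{(k,j)})+Q-\gamma^2 (L_p^{k-1})^\top L_p^{k-1}+(K_p^{(k,j-1)})^\top RK_p^{(k,j-1)}=0,\qquad K_p^{(k,j)}=\mathscr K^1(P^{(k,j)}).$$ For $\rho>0$ let $\mathcal G_\rho(L)$ be the set of all $K$ such that $(K,L)$ is stabilizing and $\mathrm{Tr}(P_K-P_L)\le\rho$,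 where $P_L$, with $0\le P_L\le P^*$, is the stabilizing solution of the outer-loop equation with $L$ in place of $L_p^{k-1}$, and $P_K$ is the symmetric solution of $\mathscr L_{K,L}(P_K)+Q-\gamma^2L^\top L+K^\top RK=0$. Then for every $\rho>0$ there is $\tilde\alpha\in(0,1)$, depending only on the data $(A,B,G,C,D,Q,R,\gamma)$ and on $\rho$, such that for every $k\ge1$ and every inner-loop iteration as above: (i) for every $j\ge 1$ with $K_p^{(k,j-1)}\in\mathcal G_\rho(L_p^{k-1})$, $$\mathrm{Tr}\big(P^{(k,j+1)}-P^k\big)\le\tilde\alpha\,\mathrm{Tr}\big(P^{(k,j)}-P^k\big);$$ (ii) consequently, if $K_p^{(k,0)}\in\mathcal G_\rho(L_p^{k-1})$, then $P^{(k,j)}\ge P^k$ and $\mathrm{Tr}(P^{(k,j)}-P^k)\le\tilde\alpha^{\,j-1}\,\mathrm{Tr}(P^{(k,1)}-P^k)$ for all $j\ge1$, i.e. the inner loop converges linearly, at a rate that does not depend on $k$ or $L_p^{k-1}$. -/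

import Mathlib

open Filter Topology

namespace RobustMF

/-- Generalized Lyapunov operator of a drift matrix `F` and a diffusion matrix `H`. -/
def lyapOp {𝕜 : Type*} [CommRing 𝕜] {n : ℕ} (F H P : Matrix (Fin n) (Fin n) 𝕜) :
    Matrix (Fin n) (Fin n) 𝕜 :=
  F.transpose * P + P * F + H.transpose * P * H

/-- The set of eigenvalues of the complexification of `P ↦ Fᵀ P + P F + Hᵀ P H` acting on the
symmetric matrices. -/
def lyapSpectrum {n : ℕ} (F H : Matrix (Fin n) (Fin n) ℝ) : Set ℂ :=
  {z | ∃ P : Matrix (Fin n) (Fin n) ℂ, P.IsSymm ∧ P ≠ 0 ∧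
    lyapOp (F.map Complex.ofReal) (H.map Complex.ofReal) P = z • P}

/-- `X t = 𝔼[x(t) x(t)ᵀ]` for a solution of `dx = F x dt + H x dw`, `t ≥ 0`, with an initial state
of finite second moment that is independent of the scalar Brownian motion `w`: the second moment
is the solution of `X' = F X + X Fᵀ + H X Hᵀ`, and `X 0` is an arbitrary positive semidefinite
matrix. -/
structure IsSecondMoment {n : ℕ} (F H : Matrix (Fin n) (Fin n) ℝ)
    (X : ℝ → Matrix (Fin n) (Fin n) ℝ) : Prop where
  init : (X 0).PosSemidef
  deriv : ∀ t : ℝ, 0 ≤ t → ∀ i j : Fin n,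
    HasDerivWithinAt (fun s => X s i j)
      ((F * X t + X t * F.transpose + H * X t * H.transpose) i j) (Set.Ici 0) t

/-- Asymptotic mean square stability of `dx = F x dt + H x dw`: `𝔼[x(t) x(t)ᵀ] → 0`
(equivalently `𝔼|x(t)|² → 0`) for every initial state. -/
def MeanSquareStable {n : ℕ} (F H : Matrix (Fin n) (Fin n) ℝ) : Prop :=
  ∀ X : ℝ → Matrix (Fin n) (Fin n) ℝ, IsSecondMoment F H X → Tendsto X atTop (𝓝 0)

/-- `[F, Q | H]` is exactly detectable: whenever the output `y = Q x` of `dx = F x dt + H x dw`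
vanishes almost surely for all `t ≥ 0` (that is, `Q 𝔼[x(t) x(t)ᵀ] = 0`), then `x(t) → 0` in mean
square. -/
def ExactlyDetectable {n : ℕ} (F Q H : Matrix (Fin n) (Fin n) ℝ) : Prop :=
  ∀ X : ℝ → Matrix (Fin n) (Fin n) ℝ, IsSecondMoment F H X →
    (∀ t : ℝ, 0 ≤ t → Q * X t = 0) → Tendsto X atTop (𝓝 0)

/-- The data: the system `[A, B, G | C, D]`, the weights `Q, R` and the attenuation level `γ`. -/
structure Data (n m₁ m₂ : ℕ) where
  A : Matrix (Fin n) (Fin n) ℝ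
  B : Matrix (Fin n) (Fin m₁) ℝ
  G : Matrix (Fin n) (Fin m₂) ℝ
  C : Matrix (Fin n) (Fin n) ℝ
  D : Matrix (Fin n) (Fin m₁) ℝ
  Q : Matrix (Fin n) (Fin n) ℝ
  R : Matrix (Fin m₁) (Fin m₁) ℝ
  γ : ℝ

namespace Data

variable {n m₁ m₂ : ℕ}

/-- `[A, B | C, D]` is stabilizable (in the mean square sense, by constant state feedback). -/
def Stabilizable (S : Data n m₁ m₂) : Prop :=
  ∃ K : Matrix (Fin m₁) (Fin n) ℝ, MeanSquareStable (S.A - S.B * K) (S.C - S.D * K)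

/-- The operator `𝓛_{[K, L]}`. -/
def lyap (S : Data n m₁ m₂) (K : Matrix (Fin m₁) (Fin n) ℝ) (L : Matrix (Fin m₂) (Fin n) ℝ)
    (P : Matrix (Fin n) (Fin n) ℝ) : Matrix (Fin n) (Fin n) ℝ :=
  lyapOp (S.A - S.B * K + S.G * L) (S.C - S.D * K) P

/-- The spectrum of `𝓛_{[K, L]}` lies in the open left half-plane. -/
def Stable (S : Data n m₁ m₂) (K : Matrix (Fin m₁) (Fin n) ℝ) (L : Matrix (Fin m₂) (Fin n) ℝ) :
    Prop :=
  lyapSpectrum (S.A - S.B * K + S.G * L) (S.C - S.D * K) ⊆ {z : ℂ | z.re < 0}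

/-- The control gain `𝒦¹(P)`. -/
noncomputable def gainK (S : Data n m₁ m₂) (P : Matrix (Fin n) (Fin n) ℝ) :
    Matrix (Fin m₁) (Fin n) ℝ :=
  (S.R + S.D.transpose * P * S.D)⁻¹ * (S.B.transpose * P + S.D.transpose * P * S.C)

/-- The disturbance gain `𝒦²(P)`. -/
noncomputable def gainL (S : Data n m₁ m₂) (P : Matrix (Fin n) (Fin n) ℝ) :
    Matrix (Fin m₂) (Fin n) ℝ :=
  (1 / S.γ ^ 2) • (S.G.transpose * P)

/-- `P` is a symmetric solution of the Lyapunov-type equation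
`𝓛_{[K, L]}(P) + Q - γ² Lᵀ L + Kᵀ R K = 0`. -/
def LyapEq (S : Data n m₁ m₂) (K : Matrix (Fin m₁) (Fin n) ℝ) (L : Matrix (Fin m₂) (Fin n) ℝ)
    (P : Matrix (Fin n) (Fin n) ℝ) : Prop :=
  P.IsSymm ∧
    S.lyap K L P + (S.Q - S.γ ^ 2 • (L.transpose * L)) + K.transpose * S.R * K = 0

/-- `P` is a positive semidefinite stabilizing solution of the `H₂`-type Riccati equation with
fixed disturbance gain `L`. -/
def IsH2Solution (S : Data n m₁ m₂) (L : Matrix (Fin m₂) (Fin n) ℝ)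
    (P : Matrix (Fin n) (Fin n) ℝ) : Prop :=
  P.PosSemidef ∧ S.LyapEq (S.gainK P) L P ∧ S.Stable (S.gainK P) L

/-- `P` is a positive semidefinite stabilizing solution of the indefinite Riccati equation
`AᵀP + PA + CᵀPC + Q + γ⁻² P G Gᵀ P`
`- (PB + CᵀPD) (R + DᵀPD)⁻¹ (BᵀP + DᵀPC) = 0`. -/
def IsGameSolution (S : Data n m₁ m₂) (P : Matrix (Fin n) (Fin n) ℝ) : Prop :=
  P.PosSemidef ∧
    S.A.transpose * P + P * S.A + S.C.transpose * P * S.C + S.Q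
      + (1 / S.γ ^ 2) • (P * S.G * S.G.transpose * P)
      - (P * S.B + S.C.transpose * P * S.D) * (S.R + S.D.transpose * P * S.D)⁻¹
        * (S.B.transpose * P + S.D.transpose * P * S.C) = 0 ∧
    S.Stable (S.gainK P) (S.gainL P)

/-- `𝒵(L)`: the gains `K` that stabilize together with `L`. -/
def stabilizers (S : Data n m₁ m₂) (L : Matrix (Fin m₂) (Fin n) ℝ) :
    Set (Matrix (Fin m₁) (Fin n) ℝ) :=
  {K | S.Stable K L}

/-- `𝒢_ρ(L) = {K ∈ 𝒵(L) | Tr(P_K - P_L) ≤ ρ}`. Here `P_L` is the solution, with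
`0 ≤ P_L ≤ Pstar`, of the `H₂`-type Riccati equation, and `P_K` is the solution of the
Lyapunov-type equation. -/
def sublevel (S : Data n m₁ m₂) (Pstar : Matrix (Fin n) (Fin n) ℝ) (ρ : ℝ)
    (L : Matrix (Fin m₂) (Fin n) ℝ) : Set (Matrix (Fin m₁) (Fin n) ℝ) :=
  {K | K ∈ S.stabilizers L ∧ ∃ PL PK : Matrix (Fin n) (Fin n) ℝ,
    S.IsH2Solution L PL ∧ (Pstar - PL).PosSemidef ∧ S.LyapEq K L PK ∧ (PK - PL).trace ≤ ρ}

/-- The outer-loop iteration: `P⁰ = 0`, `Lᵏ = 𝒦²(Pᵏ)`, and `Pᵏ⁺¹` is the stabilizing solution of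
the `H₂`-type Riccati equation with disturbance gain `Lᵏ`. -/
structure IsOuterLoop (S : Data n m₁ m₂) (P : ℕ → Matrix (Fin n) (Fin n) ℝ)
    (L : ℕ → Matrix (Fin m₂) (Fin n) ℝ) : Prop where
  init : P 0 = 0
  gain : ∀ k, L k = S.gainL (P k)
  step : ∀ k, S.IsH2Solution (L k) (P (k + 1))

/-- The inner-loop iteration with fixed disturbance gain `L` (policy evaluation and policy
improvement); `K j` and `P j` are the `j`-th iterates, the value `P 0` is not used. -/
structure IsInnerLoop (S : Data n m₁ m₂) (L : Matrix (Fin m₂) (Fin n) ℝ)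
    (K : ℕ → Matrix (Fin m₁) (Fin n) ℝ) (P : ℕ → Matrix (Fin n) (Fin n) ℝ) : Prop where
  evaluation : ∀ j, 1 ≤ j → S.LyapEq (K (j - 1)) L (P j)
  improvement : ∀ j, 1 ≤ j → K j = S.gainK (P j)

end Data

end RobustMF

/-! The argument rests on a certificate and an identity. Stability is used through a matrix `U > 0`
with negative definite Lyapunov image. It yields a maximum principle (`LyapStable.posSemidef`),
turning inequalities between Lyapunov images into matrix inequalities, and a robustness statement
(`LyapStable.of_detectable`). Completion of squares (`Data.ham_eq`) writes the Hamiltonian at any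
gains as the Riccati residual plus a control square minus a disturbance square, so comparing two
values becomes comparing squares.

For one policy step, let `E` be the square in the change of gain. Since `-E` is the Lyapunov image
of `P - P'` under the improved gain, its trace is at most a multiple of `Tr(P - P')`. Under the
optimal gain, a certificate `U` with image at most `-1` gives `P - PL ≤ Tr(E) U`. Hence `Tr(P - PL)
≤ θ Tr(P - P')`, which is a contraction by `1 - 1/θ` (`IsH2Solution.trace_contract`).

Uniformity in `k` requires bounds on `Tr U` and on the drift. The outer loop is unique, increasing
and bounded by `Pstar`. A limit of stable closed loops need not be stable, so convergence to `Pstar`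
is not read off from the limiting equation. Instead, a maximum principle for a pair of systems, one
from the loop and one at `Pstar`, bounds the gap by the last increment
(`IsOuterLoop.exists_trace_le`). Convergence then lets one certificate at `Pstar` serve all large
`k`, leaving finitely many others. Compactness of bounded sets of positive semidefinite matrices
bounds the drift. -/

namespace RobustMF

open Matrix

/-! ### Quadratic forms, Rayleigh quotients and trace bounds. -/

section QuadraticForms

variable {ι κ μ : Type*} [Fintype ι] [Fintype κ] [Fintype μ]

/-- The bilinear form `xᵀ M y`. -/
def bil (M : Matrix ι κ ℝ) (x : ι → ℝ) (y : κ → ℝ) : ℝ := x ⬝ᵥ (M *ᵥ y)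

lemma bil_add (M N : Matrix ι κ ℝ) (x y) : bil (M + N) x y = bil M x y + bil N x y := by
  simp [bil, add_mulVec, dotProduct_add]

lemma bil_sub (M N : Matrix ι κ ℝ) (x y) : bil (M - N) x y = bil M x y - bil N x y := by
  simp [bil, sub_mulVec, dotProduct_sub]

lemma bil_neg (M : Matrix ι κ ℝ) (x y) : bil (-M) x y = -bil M x y := by
  simp [bil, neg_mulVec, dotProduct_neg]

lemma bil_smul (c : ℝ) (M : Matrix ι κ ℝ) (x y) : bil (c • M) x y = c * bil M x y := by
  simp [bil, smul_mulVec, dotProduct_smul]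

lemma bil_mul (M : Matrix ι μ ℝ) (N : Matrix μ κ ℝ) (x y) :
    bil (M * N) x y = bil M x (N *ᵥ y) := by
  simp [bil, mulVec_mulVec]

lemma bil_transpose_mul (M : Matrix μ ι ℝ) (N : Matrix μ κ ℝ) (x y) :
    bil (Mᵀ * N) x y = bil N (M *ᵥ x) y := by
  simp only [bil, ← mulVec_mulVec]
  rw [dotProduct_mulVec, vecMul_transpose]

lemma bil_comm (M : Matrix ι κ ℝ) (x y) : bil M x y = bil Mᵀ y x := by
  simp only [bil]
  rw [dotProduct_mulVec, dotProduct_comm, ← mulVec_transpose]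

lemma bil_add_left (M : Matrix ι κ ℝ) (x x' y) : bil M (x + x') y = bil M x y + bil M x' y := by
  simp [bil, add_dotProduct]

lemma bil_add_right (M : Matrix ι κ ℝ) (x y y') : bil M x (y + y') = bil M x y + bil M x y' := by
  simp [bil, mulVec_add, dotProduct_add]

lemma bil_smul_left (M : Matrix ι κ ℝ) (c : ℝ) (x y) : bil M (c • x) y = c * bil M x y := by
  simp [bil, smul_dotProduct]

lemma bil_smul_right (M : Matrix ι κ ℝ) (c : ℝ) (x y) : bil M x (c • y) = c * bil M x y := by
  simp [bil, mulVec_smul, dotProduct_smul]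

lemma posSemidef_iff_bil {M : Matrix ι ι ℝ} :
    M.PosSemidef ↔ M.IsSymm ∧ ∀ x, 0 ≤ bil M x x := by
  rw [posSemidef_iff_dotProduct_mulVec]
  simp [bil, IsHermitian, IsSymm, conjTranspose_eq_transpose_of_trivial]

lemma posDef_iff_bil {M : Matrix ι ι ℝ} :
    M.PosDef ↔ M.IsSymm ∧ ∀ x, x ≠ 0 → 0 < bil M x x := by
  rw [posDef_iff_dotProduct_mulVec]
  simp [bil, IsHermitian, IsSymm, conjTranspose_eq_transpose_of_trivial]

lemma isSymm_of_posSemidef {M : Matrix ι ι ℝ} (h : M.PosSemidef) : M.IsSymm :=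
  (posSemidef_iff_bil.1 h).1

lemma bil_nonneg {M : Matrix ι ι ℝ} (h : M.PosSemidef) (x) : 0 ≤ bil M x x :=
  (posSemidef_iff_bil.1 h).2 x

lemma bil_pos {M : Matrix ι ι ℝ} (h : M.PosDef) {x} (hx : x ≠ 0) : 0 < bil M x x :=
  (posDef_iff_bil.1 h).2 x hx

lemma bil_one [DecidableEq ι] (x y : ι → ℝ) : bil (1 : Matrix ι ι ℝ) x y = x ⬝ᵥ y := by
  simp [bil]

lemma continuous_bil (M : Matrix ι ι ℝ) : Continuous fun x : ι → ℝ => bil M x x := by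
  unfold bil; fun_prop

/-- The sum of the absolute values of the entries. -/
def entrySum (M : Matrix ι κ ℝ) : ℝ := ∑ i, ∑ j, |M i j|

lemma entrySum_nonneg (M : Matrix ι κ ℝ) : 0 ≤ entrySum M :=
  Finset.sum_nonneg fun _ _ => Finset.sum_nonneg fun _ _ => abs_nonneg _

lemma continuous_entrySum : Continuous (entrySum : Matrix ι κ ℝ → ℝ) := by
  unfold entrySum
  fun_prop

lemma sq_le_dotProduct (x : ι → ℝ) (i : ι) : x i ^ 2 ≤ x ⬝ᵥ x := by
  have : x i * x i ≤ ∑ j, x j * x j :=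
    Finset.single_le_sum (f := fun j => x j * x j) (fun j _ => mul_self_nonneg _) (Finset.mem_univ i)
  simpa [dotProduct, sq] using this

lemma abs_bil_le (M : Matrix ι ι ℝ) (x) : |bil M x x| ≤ entrySum M * (x ⬝ᵥ x) := by
  have : bil M x x = ∑ i, ∑ j, M i j * (x i * x j) := by
    simp only [bil, dotProduct, mulVec, Finset.mul_sum]
    exact Finset.sum_congr rfl fun i _ => Finset.sum_congr rfl fun j _ => by ring
  rw [this, entrySum, Finset.sum_mul]
  refine (Finset.abs_sum_le_sum_abs _ _).trans (Finset.sum_le_sum fun i _ => ?_)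
  rw [Finset.sum_mul]
  refine (Finset.abs_sum_le_sum_abs _ _).trans (Finset.sum_le_sum fun j _ => ?_)
  rw [abs_mul]
  refine mul_le_mul_of_nonneg_left ?_ (abs_nonneg _)
  rw [abs_le]
  have h1 := sq_le_dotProduct x i
  have h2 := sq_le_dotProduct x j
  constructor <;> nlinarith [sq_nonneg (x i - x j), sq_nonneg (x i + x j)]

lemma bil_le (M : Matrix ι ι ℝ) (x) : bil M x x ≤ entrySum M * (x ⬝ᵥ x) :=
  (le_abs_self _).trans (abs_bil_le M x)

lemma dotProduct_self_nonneg' (x : ι → ℝ) : 0 ≤ x ⬝ᵥ x :=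
  Finset.sum_nonneg fun _ _ => mul_self_nonneg _

lemma dotProduct_self_pos {x : ι → ℝ} (hx : x ≠ 0) : 0 < x ⬝ᵥ x :=
  lt_of_le_of_ne (dotProduct_self_nonneg' x) fun h => hx (dotProduct_self_eq_zero.1 h.symm)

/-- The minimum of a generalised Rayleigh quotient is attained. -/
lemma exists_rayleigh_min [Nonempty ι] (X : Matrix ι ι ℝ) {U : Matrix ι ι ℝ} (hU : U.PosDef) :
    ∃ v : ι → ℝ, v ≠ 0 ∧ ∀ x : ι → ℝ,
      bil X v v / bil U v v * bil U x x ≤ bil X x x := by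
  -- The sphere is that of the sup norm; any compact sphere serves, because the quotient is
  -- homogeneous of degree zero.
  have hne : (Metric.sphere (0 : ι → ℝ) 1).Nonempty := NormedSpace.sphere_nonempty.2 zero_le_one
  have hcont : ContinuousOn (fun x : ι → ℝ => bil X x x / bil U x x) (Metric.sphere 0 1) := by
    refine (continuous_bil X).continuousOn.div (continuous_bil U).continuousOn fun x hx => ?_
    exact (bil_pos hU (ne_zero_of_mem_unit_sphere ⟨x, hx⟩)).ne'
  obtain ⟨v, hv, hmin⟩ := (isCompact_sphere (0 : ι → ℝ) 1).exists_isMinOn hne hcont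
  refine ⟨v, ne_zero_of_mem_unit_sphere ⟨v, hv⟩, fun x => ?_⟩
  rcases eq_or_ne x 0 with rfl | hx
  · simp [bil]
  have hn : 0 < ‖x‖ := norm_pos_iff.2 hx
  have hx' : ‖x‖⁻¹ • x ∈ Metric.sphere (0 : ι → ℝ) 1 := by
    simp [norm_smul, hn.ne']
  have := hmin hx'
  simp only [Set.mem_ofPred_eq, bil_smul_left, bil_smul_right] at this
  have hp := bil_pos hU hx
  rw [← le_div_iff₀ hp]
  refine this.trans (le_of_eq ?_)
  field_simp

lemma exists_pos_le_bil [DecidableEq ι] {M : Matrix ι ι ℝ} (hM : M.PosDef) :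
    ∃ r : ℝ, 0 < r ∧ ∀ x, r * (x ⬝ᵥ x) ≤ bil M x x := by
  rcases isEmpty_or_nonempty ι with h | h
  · exact ⟨1, one_pos, fun x => by simp [bil, dotProduct]⟩
  obtain ⟨v, hv, hmin⟩ := exists_rayleigh_min M (PosDef.one (n := ι) (R := ℝ))
  simp only [bil_one] at hmin
  exact ⟨_, div_pos (bil_pos hM hv) (dotProduct_self_pos hv), hmin⟩

/-- Testing on `e_i ± e_j` bounds twice the entry by the sum of two diagonal entries. The trace thus
acts as a norm on positive semidefinite matrices, which is what compactness and convergence use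
below. -/
lemma abs_apply_le_trace [DecidableEq ι] {M : Matrix ι ι ℝ} (hM : M.PosSemidef) (i j : ι) :
    |M i j| ≤ M.trace := by
  have hs : M j i = M i j := (isSymm_of_posSemidef hM).apply i j
  have hd : ∀ k, M k k ≤ M.trace := fun k =>
    Finset.single_le_sum (f := fun k => M k k) (fun k _ => hM.diag_nonneg) (Finset.mem_univ k)
  have e : ∀ a b, bil M (Pi.single a 1) (Pi.single b 1) = M a b := fun a b => by
    simp [bil]
  have h1 := bil_nonneg hM (Pi.single i 1 + Pi.single j 1)
  have h2 := bil_nonneg hM (Pi.single i 1 + (-1 : ℝ) • Pi.single j 1)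
  simp only [bil_add_left, bil_add_right, bil_smul_left, bil_smul_right, e, hs] at h1 h2
  have := hd i
  have := hd j
  rw [abs_le]
  constructor <;> linarith

lemma abs_trace_mul_le [DecidableEq ι] (F : Matrix ι ι ℝ) {M : Matrix ι ι ℝ} (hM : M.PosSemidef) :
    |(F * M).trace| ≤ entrySum F * M.trace := by
  simp only [trace, diag_apply, mul_apply, entrySum, Finset.sum_mul]
  refine (Finset.abs_sum_le_sum_abs _ _).trans (Finset.sum_le_sum fun i _ => ?_)
  refine (Finset.abs_sum_le_sum_abs _ _).trans (Finset.sum_le_sum fun j _ => ?_)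
  rw [abs_mul]
  exact mul_le_mul_of_nonneg_left (abs_apply_le_trace hM j i) (abs_nonneg _)

/-- With `M = Nᵀ N` the trace is the sum of the squared entries of `N`, and Cauchy–Schwarz applies
to each row. -/
lemma posSemidef_trace_smul_one_sub [DecidableEq ι] {M : Matrix ι ι ℝ} (hM : M.PosSemidef) :
    (M.trace • (1 : Matrix ι ι ℝ) - M).PosSemidef := by
  have hs := isSymm_of_posSemidef hM
  rcases isEmpty_or_nonempty ι with h | h
  · rw [Subsingleton.elim (M.trace • (1 : Matrix ι ι ℝ) - M) 0]; exact PosSemidef.zero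
  rw [posSemidef_iff_bil]
  refine ⟨by rw [IsSymm]; simp [hs.eq], fun x => ?_⟩
  have hxx : bil (1 : Matrix ι ι ℝ) x x = ∑ i, x i * x i := bil_one x x
  obtain ⟨N, rfl⟩ : ∃ N : Matrix ι ι ℝ, M = Nᴴ * N := by
    open scoped MatrixOrder in
    have := (CStarAlgebra.nonneg_iff_eq_star_mul_self (a := M)).1 hM.nonneg
    exact this
  rw [conjTranspose_eq_transpose_of_trivial, bil_sub, bil_smul, bil_transpose_mul, hxx]
  have key : bil N (N *ᵥ x) x = ∑ i, (∑ j, N i j * x j) ^ 2 := by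
    simp only [bil, dotProduct, mulVec, sq]
  rw [key, sub_nonneg]
  have ht : (Nᵀ * N).trace = ∑ i, ∑ j, N i j ^ 2 := by
    simp only [trace, diag_apply, mul_apply, transpose_apply]
    rw [Finset.sum_comm]
    exact Finset.sum_congr rfl fun i _ => Finset.sum_congr rfl fun j _ => by ring
  rw [ht, Finset.sum_mul]
  refine Finset.sum_le_sum fun i _ => ?_
  refine (Finset.sum_mul_sq_le_sq_mul_sq _ _ _).trans (le_of_eq ?_)
  simp [sq]

end QuadraticForms

/-! ### Lyapunov operators, the maximum principle and robust stability. -/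

section Lyapunov

variable {ι κ μ : Type*} [Fintype ι] [Fintype κ] [Fintype μ]

/-- The Lyapunov-type operator that mixes two systems. -/
def mixedLyap (F₁ H₁ : Matrix ι ι ℝ) (F₂ H₂ : Matrix κ κ ℝ) (Z : Matrix ι κ ℝ) : Matrix ι κ ℝ :=
  F₁ᵀ * Z + Z * F₂ + H₁ᵀ * Z * H₂

/-- The generalized Lyapunov operator over an arbitrary index type. -/
abbrev lyapunov (F H : Matrix ι ι ℝ) (X : Matrix ι ι ℝ) : Matrix ι ι ℝ := mixedLyap F H F H X

/-- Stability in the sense of Lyapunov inequalities. -/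
def LyapStable (F H : Matrix ι ι ℝ) : Prop :=
  ∃ U : Matrix ι ι ℝ, U.PosDef ∧ (-(lyapunov F H U)).PosDef

lemma bil_mixedLyap (F₁ H₁ : Matrix ι ι ℝ) (F₂ H₂ : Matrix κ κ ℝ) (Z : Matrix ι κ ℝ) (x y) :
    bil (mixedLyap F₁ H₁ F₂ H₂ Z) x y =
      bil Z (F₁ *ᵥ x) y + bil Z x (F₂ *ᵥ y) + bil Z (H₁ *ᵥ x) (H₂ *ᵥ y) := by
  rw [mixedLyap, bil_add, bil_add, bil_transpose_mul, bil_mul Z, bil_mul _ H₂, bil_transpose_mul]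

lemma mixedLyap_transpose (F₁ H₁ : Matrix ι ι ℝ) (F₂ H₂ : Matrix κ κ ℝ) (Z : Matrix ι κ ℝ) :
    (mixedLyap F₁ H₁ F₂ H₂ Z)ᵀ = mixedLyap F₂ H₂ F₁ H₁ Zᵀ := by
  simp only [mixedLyap, transpose_add, transpose_mul, transpose_transpose, Matrix.mul_assoc]
  abel

lemma lyapunov_isSymm (F H : Matrix ι ι ℝ) {X : Matrix ι ι ℝ} (hX : X.IsSymm) :
    (lyapunov F H X).IsSymm := by
  rw [IsSymm, mixedLyap_transpose, hX.eq]

lemma mixedLyap_add (F₁ H₁ : Matrix ι ι ℝ) (F₂ H₂ : Matrix κ κ ℝ) (Y Z : Matrix ι κ ℝ) :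
    mixedLyap F₁ H₁ F₂ H₂ (Y + Z) = mixedLyap F₁ H₁ F₂ H₂ Y + mixedLyap F₁ H₁ F₂ H₂ Z := by
  simp only [mixedLyap, Matrix.mul_add, Matrix.add_mul]; abel

lemma mixedLyap_smul (F₁ H₁ : Matrix ι ι ℝ) (F₂ H₂ : Matrix κ κ ℝ) (c : ℝ) (Z : Matrix ι κ ℝ) :
    mixedLyap F₁ H₁ F₂ H₂ (c • Z) = c • mixedLyap F₁ H₁ F₂ H₂ Z := by
  simp only [mixedLyap, Matrix.mul_smul, Matrix.smul_mul, smul_add]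

lemma mixedLyap_sub (F₁ H₁ : Matrix ι ι ℝ) (F₂ H₂ : Matrix κ κ ℝ) (Y Z : Matrix ι κ ℝ) :
    mixedLyap F₁ H₁ F₂ H₂ (Y - Z) = mixedLyap F₁ H₁ F₂ H₂ Y - mixedLyap F₁ H₁ F₂ H₂ Z := by
  simp only [mixedLyap, Matrix.mul_sub, Matrix.sub_mul]; abel

/-- The maximum principle: for a stable system a supersolution is nonnegative. -/
lemma LyapStable.posSemidef {F H : Matrix ι ι ℝ} (h : LyapStable F H) {X : Matrix ι ι ℝ}
    (hX : X.IsSymm) (hL : (-(lyapunov F H X)).PosSemidef) : X.PosSemidef := by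
  obtain ⟨U, hU, hUL⟩ := h
  rcases isEmpty_or_nonempty ι with hι | hι
  · rw [Subsingleton.elim X 0]; exact PosSemidef.zero
  obtain ⟨v, hv, hmin⟩ := exists_rayleigh_min X hU
  set c := bil X v v / bil U v v with hc
  have hUv := bil_pos hU hv
  by_cases hc0 : 0 ≤ c
  · refine posSemidef_iff_bil.2 ⟨hX, fun x => le_trans ?_ (hmin x)⟩
    exact mul_nonneg hc0 (bil_nonneg hU.posSemidef x)
  exfalso
  have hUs := isSymm_of_posSemidef hU.posSemidef
  -- If the minimum `c` were negative, `X - c U` would be nonnegative with `v` in its kernel. At `v`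
  -- the drift terms vanish, so its Lyapunov image is nonnegative there, while the hypotheses make
  -- it negative.
  have hW : (X - c • U).PosSemidef := by
    refine posSemidef_iff_bil.2 ⟨?_, fun x => ?_⟩
    · rw [IsSymm, transpose_sub, transpose_smul, hX.eq, hUs.eq]
    · rw [bil_sub, bil_smul]; linarith [hmin x]
  have hWv : (X - c • U) *ᵥ v = 0 := by
    have := (hW.dotProduct_mulVec_zero_iff v).1 (by
      change bil (X - c • U) (star v) v = 0
      rw [star_trivial, bil_sub, bil_smul, hc]; field_simp; ring)
    exact this
  have h0 : ∀ x, bil (X - c • U) x v = 0 := fun x => by simp [bil, hWv]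
  have h0' : ∀ x, bil (X - c • U) v x = 0 := fun x => by
    rw [bil_comm, (isSymm_of_posSemidef hW).eq, h0]
  have h1 := bil_mixedLyap F H F H (X - c • U) v v
  rw [h0, h0', mixedLyap_sub, mixedLyap_smul, bil_sub, bil_smul] at h1
  have h2 := bil_nonneg hW (H *ᵥ v)
  have h3 := bil_nonneg hL v
  have h4 := bil_pos hUL hv
  rw [bil_neg] at h3 h4
  nlinarith [not_le.1 hc0]

lemma eq_of_posSemidef_sub {X Y : Matrix ι ι ℝ} (h₁ : (X - Y).PosSemidef)
    (h₂ : (Y - X).PosSemidef) : X = Y := by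
  classical
  have h3 : (X - Y).trace = 0 := by
    have a := h₁.trace_nonneg
    have b := h₂.trace_nonneg
    rw [trace_sub] at a b ⊢
    linarith
  ext i j
  have := abs_apply_le_trace h₁ i j
  rw [h3] at this
  simpa [sub_eq_zero] using abs_nonpos_iff.1 this

/-- A stable system remains stable under a perturbation that is seen by the output of a
nonnegative supersolution. -/
lemma LyapStable.of_detectable [DecidableEq ι] [DecidableEq μ] {F H : Matrix ι ι ℝ}
    (h : LyapStable F H) (N S : Matrix ι μ ℝ) (Δ : Matrix μ ι ℝ) {R : Matrix μ μ ℝ}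
    (hR : R.PosDef) {X : Matrix ι ι ℝ} (hX : X.PosSemidef)
    (hL : (-(lyapunov (F + N * Δ) (H + S * Δ) X) - Δᵀ * R * Δ).PosSemidef) :
    LyapStable (F + N * Δ) (H + S * Δ) := by
  obtain ⟨U, hU, hUL⟩ := h
  obtain ⟨δ, hδ, hδU⟩ := exists_pos_le_bil hUL
  obtain ⟨r, hr, hrR⟩ := exists_pos_le_bil hR
  have hUs := isSymm_of_posSemidef hU.posSemidef
  set M : Matrix μ ι ℝ := Nᵀ * U + Sᵀ * U * H with hM
  set m := entrySum (Mᵀ * M) with hm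
  have hm0 : 0 ≤ m := entrySum_nonneg _
  set s := entrySum (Sᵀ * U * S) with hs
  have hs0 : 0 ≤ s := entrySum_nonneg _
  -- The new certificate is `U + k X`. The cross term in `Δ x` is split by Young's inequality: half
  -- of the margin `δ` absorbs the `x` part. The rest, a multiple `t + 1 + s` of `|Δ x|²`, is paid
  -- for by `k X`. The summand `1` keeps the Young weight positive when `m = 0`.
  set t := 2 * m / δ with ht
  have ht0 : 0 ≤ t := by positivity
  set k := (t + 1 + s) / r with hk
  have hk0 : 0 ≤ k := by positivity
  refine ⟨U + k • X, hU.add_posSemidef (hX.smul hk0), posDef_iff_bil.2 ⟨?_, fun x hx => ?_⟩⟩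
  · rw [IsSymm, transpose_neg, (lyapunov_isSymm _ _ _).eq]
    rw [IsSymm, transpose_add, transpose_smul, hUs.eq, (isSymm_of_posSemidef hX).eq]
  set d := Δ *ᵥ x with hd
  have hxx := dotProduct_self_pos hx
  have e1 : bil (lyapunov (F + N * Δ) (H + S * Δ) U) x x =
      bil (lyapunov F H U) x x + 2 * (d ⬝ᵥ (M *ᵥ x)) + bil (Sᵀ * U * S) d d := by
    have hc : ∀ a b, bil U a b = bil U b a := fun a b => by rw [bil_comm, hUs.eq]
    have eM : d ⬝ᵥ (M *ᵥ x) = bil U (N *ᵥ d) x + bil U (S *ᵥ d) (H *ᵥ x) := by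
      change bil M d x = _
      rw [hM, bil_add, bil_transpose_mul, bil_mul _ H, bil_transpose_mul]
    rw [eM, bil_mixedLyap, bil_mixedLyap, bil_mul _ S, bil_transpose_mul]
    simp only [add_mulVec, ← mulVec_mulVec, ← hd, bil_add_left, bil_add_right]
    rw [hc x (N *ᵥ d), hc (H *ᵥ x) (S *ᵥ d)]
    ring
  have e2 := bil_nonneg hL x
  rw [bil_sub, bil_neg, bil_mul _ Δ, bil_transpose_mul, ← hd] at e2
  have e3 := hrR d
  have e4 := hδU x
  have e5 := bil_le (Sᵀ * U * S) d
  have e6 : (M *ᵥ x) ⬝ᵥ (M *ᵥ x) ≤ m * (x ⬝ᵥ x) := by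
    have := bil_le (Mᵀ * M) x
    rwa [bil_transpose_mul] at this
  rw [bil_neg] at e4
  rw [bil_neg, lyapunov, mixedLyap_add, mixedLyap_smul, ← lyapunov, ← lyapunov, bil_add, bil_smul, e1]
  have e7 : 2 * (d ⬝ᵥ (M *ᵥ x)) ≤ (t + 1) * (d ⬝ᵥ d) + (δ / 2) * (x ⬝ᵥ x) := by
    have h1 := dotProduct_self_nonneg' ((t + 1) • d - M *ᵥ x)
    simp only [sub_dotProduct, dotProduct_sub, smul_dotProduct, dotProduct_smul, smul_eq_mul] at h1
    rw [dotProduct_comm (M *ᵥ x) d] at h1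
    have h2 : m * (x ⬝ᵥ x) ≤ (t + 1) * ((δ / 2) * (x ⬝ᵥ x)) := by
      have : m = t * (δ / 2) := by rw [ht]; field_simp
      rw [this]
      have : 0 ≤ δ / 2 * (x ⬝ᵥ x) := by positivity
      linarith
    have h3 : 0 < t + 1 := by positivity
    have h4 : (t + 1) * (2 * (d ⬝ᵥ (M *ᵥ x))) ≤
        (t + 1) * ((t + 1) * (d ⬝ᵥ d) + (δ / 2) * (x ⬝ᵥ x)) := by linarith
    exact le_of_mul_le_mul_left h4 h3
  have e8 : (t + 1 + s) * (d ⬝ᵥ d) ≤ k * bil R d d := by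
    have : (t + 1 + s) = k * r := by rw [hk]; field_simp
    rw [this, mul_assoc]
    exact mul_le_mul_of_nonneg_left e3 hk0
  have e9 : k * bil R d d ≤ k * -bil (lyapunov (F + N * Δ) (H + S * Δ) X) x x :=
    mul_le_mul_of_nonneg_left (by linarith) hk0
  have e10 : 0 < δ * (x ⬝ᵥ x) := by positivity
  linarith

/-- The block diagonal of the two certificates is a certificate, so the maximum principle applies to
the joint system and gives the one for pairs. -/
lemma LyapStable.fromBlocks [DecidableEq ι] [DecidableEq κ] {F₁ H₁ : Matrix ι ι ℝ}
    {F₂ H₂ : Matrix κ κ ℝ} (h₁ : LyapStable F₁ H₁) (h₂ : LyapStable F₂ H₂) :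
    LyapStable (fromBlocks F₁ 0 0 F₂) (fromBlocks H₁ 0 0 H₂) := by
  obtain ⟨U, hU, hUL⟩ := h₁
  obtain ⟨V, hV, hVL⟩ := h₂
  have key : ∀ {X : Matrix ι ι ℝ} {Y : Matrix κ κ ℝ}, X.PosDef → Y.PosDef →
      (Matrix.fromBlocks X 0 0 Y).PosDef := by
    intro X Y hX hY
    refine posDef_iff_bil.2 ⟨?_, fun x hx => ?_⟩
    · rw [IsSymm, fromBlocks_transpose, (isSymm_of_posSemidef hX.posSemidef).eq,
        (isSymm_of_posSemidef hY.posSemidef).eq]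
      simp
    · have : bil (Matrix.fromBlocks X 0 0 Y) x x =
          bil X (x ∘ Sum.inl) (x ∘ Sum.inl) + bil Y (x ∘ Sum.inr) (x ∘ Sum.inr) := by
        simp [bil, fromBlocks_mulVec, dotProduct, Fintype.sum_sum_type]
      rw [this]
      by_cases h : x ∘ Sum.inl = 0
      · have h' : x ∘ Sum.inr ≠ 0 := fun h' => hx (by
          ext i; rcases i with i | i
          · exact congrFun h i
          · exact congrFun h' i)
        exact add_pos_of_nonneg_of_pos (bil_nonneg hX.posSemidef _) (bil_pos hY h')
      · exact add_pos_of_pos_of_nonneg (bil_pos hX h) (bil_nonneg hY.posSemidef _)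
  refine ⟨_, key hU hV, ?_⟩
  have := key hUL hVL
  convert this using 1
  simp [mixedLyap, fromBlocks_transpose, fromBlocks_multiply, fromBlocks_add, fromBlocks_neg]

/-- The maximum principle for a pair of stable systems. -/
lemma LyapStable.bil_block_nonneg [DecidableEq ι] [DecidableEq κ] {F₁ H₁ : Matrix ι ι ℝ}
    {F₂ H₂ : Matrix κ κ ℝ} (h₁ : LyapStable F₁ H₁) (h₂ : LyapStable F₂ H₂)
    {X : Matrix ι ι ℝ} {Y : Matrix κ κ ℝ} (Z : Matrix ι κ ℝ) (hX : X.IsSymm) (hY : Y.IsSymm)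
    (hL : ∀ x y, bil (lyapunov F₁ H₁ X) x x + 2 * bil (mixedLyap F₁ H₁ F₂ H₂ Z) x y
      + bil (lyapunov F₂ H₂ Y) y y ≤ 0) (x : ι → ℝ) (y : κ → ℝ) :
    0 ≤ bil X x x + 2 * bil Z x y + bil Y y y := by
  have expand : ∀ (X : Matrix ι ι ℝ) (Y : Matrix κ κ ℝ) (Z : Matrix ι κ ℝ) (x : ι ⊕ κ → ℝ),
      bil (Matrix.fromBlocks X Z Zᵀ Y) x x = bil X (x ∘ Sum.inl) (x ∘ Sum.inl)
        + 2 * bil Z (x ∘ Sum.inl) (x ∘ Sum.inr) + bil Y (x ∘ Sum.inr) (x ∘ Sum.inr) := by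
    intro X Y Z x
    have h : bil (Matrix.fromBlocks X Z Zᵀ Y) x x = bil X (x ∘ Sum.inl) (x ∘ Sum.inl)
        + bil Z (x ∘ Sum.inl) (x ∘ Sum.inr) + (bil Zᵀ (x ∘ Sum.inr) (x ∘ Sum.inl)
        + bil Y (x ∘ Sum.inr) (x ∘ Sum.inr)) := by
      simp [bil, fromBlocks_mulVec, dotProduct, Fintype.sum_sum_type, mul_add,
        Finset.sum_add_distrib]
    rw [h, bil_comm Zᵀ, transpose_transpose]; ring
  have hsymm : ∀ {X : Matrix ι ι ℝ} {Y : Matrix κ κ ℝ} (Z : Matrix ι κ ℝ), X.IsSymm → Y.IsSymm →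
      (Matrix.fromBlocks X Z Zᵀ Y).IsSymm := fun Z hX hY => by
    rw [IsSymm, fromBlocks_transpose, hX.eq, hY.eq, transpose_transpose]
  have hlyap : lyapunov (Matrix.fromBlocks F₁ 0 0 F₂) (Matrix.fromBlocks H₁ 0 0 H₂)
      (Matrix.fromBlocks X Z Zᵀ Y) = Matrix.fromBlocks (lyapunov F₁ H₁ X)
        (mixedLyap F₁ H₁ F₂ H₂ Z) (mixedLyap F₁ H₁ F₂ H₂ Z)ᵀ (lyapunov F₂ H₂ Y) := by
    rw [mixedLyap_transpose]
    simp [mixedLyap, fromBlocks_transpose, fromBlocks_multiply, fromBlocks_add]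
  have := (h₁.fromBlocks h₂).posSemidef (X := Matrix.fromBlocks X Z Zᵀ Y) (hsymm Z hX hY) (by
    refine posSemidef_iff_bil.2 ⟨?_, fun z => ?_⟩
    · rw [IsSymm, transpose_neg, (lyapunov_isSymm _ _ (hsymm Z hX hY)).eq]
    · rw [bil_neg, hlyap, expand]
      linarith [hL (z ∘ Sum.inl) (z ∘ Sum.inr)])
  have h2 := bil_nonneg this (Sum.elim x y)
  rw [expand] at h2
  simpa using h2

end Lyapunov

/-! ### From the spectral condition to a Lyapunov certificate. -/

section Spectrum

variable {n : ℕ}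

/-- The subspace of symmetric matrices. -/
def symmSubmodule (n : ℕ) : Submodule ℝ (Matrix (Fin n) (Fin n) ℝ) where
  carrier := {X | X.IsSymm}
  add_mem' hX hY := IsSymm.add hX hY
  zero_mem' := isSymm_zero
  smul_mem' c _ hX := IsSymm.smul hX c

/-- The Lyapunov operator minus `s`, on the symmetric matrices. -/
def shiftedLyap (F H : Matrix (Fin n) (Fin n) ℝ) (s : ℝ) :
    symmSubmodule n →ₗ[ℝ] symmSubmodule n where
  toFun X := ⟨lyapunov F H X.1 - s • X.1, (lyapunov_isSymm F H X.2).sub (IsSymm.smul X.2 s)⟩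
  map_add' X Y := by
    ext1
    simp only [Submodule.coe_add, lyapunov, mixedLyap_add, smul_add]
    abel
  map_smul' c X := by
    ext1
    simp only [Submodule.coe_smul, lyapunov, mixedLyap_smul, smul_sub, smul_comm s c,
      RingHom.id_apply]

/-- Injectivity implies surjectivity on the finite-dimensional space of symmetric matrices. -/
lemma exists_lyapunov_sub_smul_eq {F H : Matrix (Fin n) (Fin n) ℝ} {s : ℝ}
    (h : ∀ X : Matrix (Fin n) (Fin n) ℝ, X.IsSymm → lyapunov F H X = s • X → X = 0)
    {Y : Matrix (Fin n) (Fin n) ℝ} (hY : Y.IsSymm) :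
    ∃ X : Matrix (Fin n) (Fin n) ℝ, X.IsSymm ∧ lyapunov F H X - s • X = Y := by
  have hinj : Function.Injective (shiftedLyap F H s) := by
    rw [← LinearMap.ker_eq_bot, LinearMap.ker_eq_bot']
    intro X hX
    exact Subtype.ext (h X.1 X.2 (sub_eq_zero.1 (congrArg Subtype.val hX)))
  obtain ⟨X, hX⟩ := (LinearMap.injective_iff_surjective.1 hinj) ⟨Y, hY⟩
  exact ⟨X.1, X.2, congrArg Subtype.val hX⟩

lemma lyapunov_sub_smul_one (F H X : Matrix (Fin n) (Fin n) ℝ) (s : ℝ) :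
    lyapunov (F - (s / 2) • 1) H X = lyapunov F H X - s • X := by
  have : s • X = (s / 2) • X + (s / 2) • X := by rw [← add_smul]; congr 1; ring
  rw [this]
  simp only [mixedLyap, transpose_sub, transpose_smul, transpose_one, Matrix.sub_mul,
    Matrix.mul_sub, Matrix.smul_mul, Matrix.mul_smul, Matrix.one_mul, Matrix.mul_one]
  abel

/-- A system whose Lyapunov operator has no nonnegative real eigenvalue is stable. -/
lemma lyapStable_of_forall_eigen {F H : Matrix (Fin n) (Fin n) ℝ}
    (h : ∀ s : ℝ, 0 ≤ s → ∀ X : Matrix (Fin n) (Fin n) ℝ, X.IsSymm →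
      lyapunov F H X = s • X → X = 0) : LyapStable F H := by
  -- Continuation in the shift: large shifts are stable, and the infimum `s₀` of the stable ones is
  -- shown to be `0` and attained.
  set T : Set ℝ := {s | 0 ≤ s ∧ LyapStable (F - (s / 2) • 1) H} with hT
  have hone : ∀ x : Fin n → ℝ, bil (1 : Matrix (Fin n) (Fin n) ℝ) x x = x ⬝ᵥ x :=
    fun x => bil_one x x
  have hbdd : BddBelow T := ⟨0, fun s hs => hs.1⟩
  have hne : T.Nonempty := by
    have he := entrySum_nonneg (lyapunov F H 1)
    refine ⟨entrySum (lyapunov F H 1) + 1, by positivity, 1, PosDef.one, ?_⟩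
    rw [posDef_iff_bil]
    refine ⟨(lyapunov_isSymm _ _ isSymm_one).neg, fun x hx => ?_⟩
    rw [bil_neg, lyapunov_sub_smul_one, bil_sub, bil_smul, hone]
    have := bil_le (lyapunov F H 1) x
    have := dotProduct_self_pos hx
    linarith
  set s₀ := sInf T with hs₀
  have hs₀0 : 0 ≤ s₀ := le_csInf hne fun s hs => hs.1
  obtain ⟨V, hVs, hV⟩ := exists_lyapunov_sub_smul_eq (h s₀ hs₀0)
    (Y := -(1 : Matrix (Fin n) (Fin n) ℝ)) isSymm_one.neg
  -- For shifts within `1 / (2 e)` of `s₀`, the error `(s₀ - s) V` costs at most half of the `-1` in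
  -- the equation for `V`.
  set e := entrySum V + 1 with he
  have he0 : 0 < e := by have := entrySum_nonneg V; positivity
  have hshift : ∀ s x, bil (lyapunov (F - (s / 2) • 1) H V) x x =
      -(x ⬝ᵥ x) + (s₀ - s) * bil V x x := by
    intro s x
    have : lyapunov (F - (s / 2) • 1) H V = -1 + (s₀ - s) • V := by
      rw [lyapunov_sub_smul_one, ← hV, sub_smul]; abel
    rw [this, bil_add, bil_neg, bil_smul, hone]
  have hsmall : ∀ s x, |s₀ - s| ≤ 1 / (2 * e) → (s₀ - s) * bil V x x ≤ (x ⬝ᵥ x) / 2 := by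
    intro s x hs
    have h1 := abs_bil_le V x
    have h2 := dotProduct_self_nonneg' x
    calc (s₀ - s) * bil V x x ≤ |s₀ - s| * |bil V x x| := by
          rw [← abs_mul]; exact le_abs_self _
      _ ≤ (1 / (2 * e)) * (e * (x ⬝ᵥ x)) := by
          refine mul_le_mul hs (h1.trans ?_) (abs_nonneg _) (by positivity)
          exact mul_le_mul_of_nonneg_right (by linarith) h2
      _ = (x ⬝ᵥ x) / 2 := by field_simp
  -- A stable shift just above `s₀` supplies the maximum principle, although stability at `s₀`
  -- itself is not yet known.
  have hVpsd : V.PosSemidef := by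
    obtain ⟨s, hsT, hslt⟩ := exists_lt_of_csInf_lt hne
      (show sInf T < s₀ + 1 / (2 * e) from lt_add_of_pos_right _ (by positivity))
    have hle : s₀ ≤ s := csInf_le hbdd hsT
    refine hsT.2.posSemidef hVs (posSemidef_iff_bil.2 ⟨(lyapunov_isSymm _ _ hVs).neg, fun x => ?_⟩)
    have := hsmall s x (by rw [abs_sub_comm, abs_of_nonneg (by linarith)]; linarith)
    have := dotProduct_self_nonneg' x
    rw [bil_neg, hshift]
    linarith
  -- At a kernel vector of `V` only the diffusion term survives; it is nonnegative, whereas the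
  -- equation makes it `-|x|²`.
  have hVpd : V.PosDef := by
    refine posDef_iff_bil.2 ⟨hVs, fun x hx => ?_⟩
    refine lt_of_le_of_ne (bil_nonneg hVpsd x) fun h0 => ?_
    have hVx : V *ᵥ x = 0 := (hVpsd.dotProduct_mulVec_zero_iff x).1 (by
      rw [star_trivial]; exact h0.symm)
    have h1 := hshift s₀ x
    have h2 : ∀ y, bil V y x = 0 := fun y => by simp [bil, hVx]
    have h2' : ∀ y, bil V x y = 0 := fun y => by rw [bil_comm, hVs.eq, h2]
    rw [sub_self, zero_mul, add_zero, bil_mixedLyap, h2, h2'] at h1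
    have h3 := bil_nonneg hVpsd (H *ᵥ x)
    have := dotProduct_self_pos hx
    linarith
  have hgood : ∀ s, |s₀ - s| ≤ 1 / (2 * e) → LyapStable (F - (s / 2) • 1) H := by
    refine fun s hs => ⟨V, hVpd, posDef_iff_bil.2 ⟨(lyapunov_isSymm _ _ hVs).neg, fun x hx => ?_⟩⟩
    have := hsmall s x hs
    have := dotProduct_self_pos hx
    rw [bil_neg, hshift]
    linarith
  have hs₀z : s₀ = 0 := by
    -- The certificate `V` works on both sides of `s₀`, so a positive infimum could be lowered.
    by_contra hne0
    have hpos : 0 < s₀ := lt_of_le_of_ne hs₀0 (Ne.symm hne0)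
    have hd : 0 < min s₀ (1 / (2 * e)) := lt_min hpos (by positivity)
    have hmem : s₀ - min s₀ (1 / (2 * e)) ∈ T := by
      refine ⟨sub_nonneg.2 (min_le_left _ _), hgood _ ?_⟩
      rw [sub_sub_cancel, abs_of_pos hd]
      exact min_le_right _ _
    have := csInf_le hbdd hmem
    linarith
  have := hgood 0 (by rw [hs₀z]; simp; positivity)
  simpa using this

/-- Only the real nonnegative eigenvalues have to be excluded; a real eigenmatrix is transported to
the complexification. -/
lemma lyapStable_of_lyapSpectrum {F H : Matrix (Fin n) (Fin n) ℝ}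
    (h : lyapSpectrum F H ⊆ {z : ℂ | z.re < 0}) : LyapStable F H := by
  refine lyapStable_of_forall_eigen fun s hs X hX hL => ?_
  by_contra hne
  have hmem : (s : ℂ) ∈ lyapSpectrum F H := by
    refine ⟨X.map Complex.ofReal, ?_, ?_, ?_⟩
    · rw [IsSymm, ← transpose_map, hX.eq]
    · intro h0
      refine hne ?_
      ext i j
      have := congrFun (congrFun h0 i) j
      simpa using this
    · have hmul : ∀ M N : Matrix (Fin n) (Fin n) ℝ,
          M.map Complex.ofReal * N.map Complex.ofReal = (M * N).map Complex.ofReal := fun M N => by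
        exact (Matrix.map_mul (f := Complex.ofRealHom)).symm
      have hadd : ∀ M N : Matrix (Fin n) (Fin n) ℝ,
          M.map Complex.ofReal + N.map Complex.ofReal = (M + N).map Complex.ofReal := fun M N => by
        ext; simp
      rw [lyapOp, ← transpose_map, ← transpose_map, hmul, hmul, hmul, hmul, hadd, hadd]
      change (lyapunov F H X).map Complex.ofReal = _
      rw [hL]
      ext; simp
  exact absurd (h hmem) (by simpa using hs)

end Spectrum

/-! ### The Hamiltonian and completion of squares. -/

namespace Data

variable {n m₁ m₂ : ℕ} (S : Data n m₁ m₂)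

/-- The closed-loop drift matrix. -/
def drift (K : Matrix (Fin m₁) (Fin n) ℝ) (L : Matrix (Fin m₂) (Fin n) ℝ) :
    Matrix (Fin n) (Fin n) ℝ := S.A - S.B * K + S.G * L

/-- The closed-loop diffusion matrix. -/
def diffusion (K : Matrix (Fin m₁) (Fin n) ℝ) : Matrix (Fin n) (Fin n) ℝ := S.C - S.D * K

/-- The weight `R + Dᵀ P D`. -/
def weight (P : Matrix (Fin n) (Fin n) ℝ) : Matrix (Fin m₁) (Fin m₁) ℝ :=
  S.R + S.Dᵀ * P * S.D

/-- The polarised Hamiltonian of the game. -/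
def ham (K₁ : Matrix (Fin m₁) (Fin n) ℝ) (L₁ : Matrix (Fin m₂) (Fin n) ℝ)
    (K₂ : Matrix (Fin m₁) (Fin n) ℝ) (L₂ : Matrix (Fin m₂) (Fin n) ℝ)
    (P : Matrix (Fin n) (Fin n) ℝ) : Matrix (Fin n) (Fin n) ℝ :=
  mixedLyap (S.drift K₁ L₁) (S.diffusion K₁) (S.drift K₂ L₂) (S.diffusion K₂) P + S.Q
    + K₁ᵀ * S.R * K₂ - S.γ ^ 2 • (L₁ᵀ * L₂)

/-- The left-hand side of the indefinite Riccati equation. -/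
noncomputable def riccati (P : Matrix (Fin n) (Fin n) ℝ) : Matrix (Fin n) (Fin n) ℝ :=
  S.ham (S.gainK P) (S.gainL P) (S.gainK P) (S.gainL P) P

/-- Mean-square stability of the closed loop in the sense of Lyapunov inequalities. -/
def LStable (K : Matrix (Fin m₁) (Fin n) ℝ) (L : Matrix (Fin m₂) (Fin n) ℝ) : Prop :=
  LyapStable (S.drift K L) (S.diffusion K)

variable {S}

lemma Stable.lStable {K : Matrix (Fin m₁) (Fin n) ℝ} {L : Matrix (Fin m₂) (Fin n) ℝ}
    (h : S.Stable K L) : S.LStable K L := lyapStable_of_lyapSpectrum h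

lemma weight_posDef (hR : S.R.PosDef) {P : Matrix (Fin n) (Fin n) ℝ} (hP : P.PosSemidef) :
    (S.weight P).PosDef := by
  have := hP.conjTranspose_mul_mul_same S.D
  rw [conjTranspose_eq_transpose_of_trivial] at this
  exact hR.add_posSemidef this

lemma ham_sub (K₁ L₁ K₂ L₂ P P') :
    S.ham K₁ L₁ K₂ L₂ P - S.ham K₁ L₁ K₂ L₂ P' =
      mixedLyap (S.drift K₁ L₁) (S.diffusion K₁) (S.drift K₂ L₂) (S.diffusion K₂) (P - P') := by
  rw [ham, ham, mixedLyap_sub]; abel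

lemma lyapEq_iff {K L P} : S.LyapEq K L P ↔ P.IsSymm ∧ S.ham K L K L P = 0 := by
  have : S.lyap K L P + (S.Q - S.γ ^ 2 • (L.transpose * L)) + K.transpose * S.R * K =
      S.ham K L K L P := by
    change lyapunov (S.drift K L) (S.diffusion K) P + _ + _ = _
    rw [ham]; abel
  rw [LyapEq, this]

lemma weight_mul_gainK (hR : S.R.PosDef) {P : Matrix (Fin n) (Fin n) ℝ} (hP : P.PosSemidef) :
    S.weight P * S.gainK P = S.Bᵀ * P + S.Dᵀ * P * S.C := by
  have hu : IsUnit (S.weight P).det := (isUnit_iff_isUnit_det _).1 (weight_posDef hR hP).isUnit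
  rw [gainK]
  exact mul_nonsing_inv_cancel_left _ _ hu

lemma gamma_smul_gainL (hγ : 0 < S.γ) (P : Matrix (Fin n) (Fin n) ℝ) :
    S.γ ^ 2 • S.gainL P = S.Gᵀ * P := by
  rw [gainL, smul_smul, mul_one_div, div_self (pow_pos hγ 2).ne', one_smul]

lemma ham_expand {P : Matrix (Fin n) (Fin n) ℝ} (hP : P.IsSymm) (K₁ L₁ K₂ L₂) :
    S.ham K₁ L₁ K₂ L₂ P = (S.Aᵀ * P + P * S.A + S.Cᵀ * P * S.C + S.Q)
      - K₁ᵀ * (S.Bᵀ * P + S.Dᵀ * P * S.C) - (S.Bᵀ * P + S.Dᵀ * P * S.C)ᵀ * K₂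
      + K₁ᵀ * S.weight P * K₂ + L₁ᵀ * (S.Gᵀ * P) + (S.Gᵀ * P)ᵀ * L₂ - S.γ ^ 2 • (L₁ᵀ * L₂) := by
  simp only [ham, mixedLyap, drift, diffusion, weight, transpose_add, transpose_sub, transpose_mul,
    transpose_transpose, hP.eq, Matrix.mul_add, Matrix.mul_sub, Matrix.add_mul, Matrix.sub_mul,
    Matrix.mul_assoc]
  abel

/-- Completion of squares. -/
lemma ham_eq (hR : S.R.PosDef) (hγ : 0 < S.γ) {P : Matrix (Fin n) (Fin n) ℝ} (hP : P.PosSemidef)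
    (K₁ L₁ K₂ L₂) :
    S.ham K₁ L₁ K₂ L₂ P = S.riccati P + (K₁ - S.gainK P)ᵀ * S.weight P * (K₂ - S.gainK P)
      - S.γ ^ 2 • ((L₁ - S.gainL P)ᵀ * (L₂ - S.gainL P)) := by
  have hs := isSymm_of_posSemidef hP
  have hW := isSymm_of_posSemidef (weight_posDef hR hP).posSemidef
  rw [riccati, ham_expand hs, ham_expand hs, ← weight_mul_gainK hR hP, ← gamma_smul_gainL hγ]
  simp only [transpose_sub, transpose_mul, transpose_smul, hW.eq, Matrix.mul_sub, Matrix.sub_mul,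
    Matrix.mul_assoc, Matrix.smul_mul, Matrix.mul_smul, smul_sub]
  abel

/-- At its own gains the cross terms of the Hamiltonian combine with the squares: the control part
leaves `-KᵀWK` and the disturbance part `+γ² LᵀL`, as in the Riccati equation. -/
lemma IsGameSolution.riccati_eq_zero (hR : S.R.PosDef) (hγ : 0 < S.γ)
    {P : Matrix (Fin n) (Fin n) ℝ} (h : S.IsGameSolution P) : S.riccati P = 0 := by
  have hP := h.1
  have hs := isSymm_of_posSemidef hP
  have hW := isSymm_of_posSemidef (weight_posDef hR hP).posSemidef
  have hg := gamma_smul_gainL hγ P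
  have h2 := h.2.1
  have e1 : (1 / S.γ ^ 2) • (P * S.G * S.Gᵀ * P) = S.γ ^ 2 • ((S.gainL P)ᵀ * S.gainL P) := by
    rw [gainL]
    simp only [transpose_smul, transpose_mul, transpose_transpose, hs.eq, Matrix.smul_mul,
      Matrix.mul_smul, smul_smul, Matrix.mul_assoc]
    congr 1
    field_simp
  have e2 : (P * S.B + S.Cᵀ * P * S.D) * (S.R + S.Dᵀ * P * S.D)⁻¹ * (S.Bᵀ * P + S.Dᵀ * P * S.C) =
      (S.gainK P)ᵀ * (S.weight P * S.gainK P) := by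
    have : P * S.B + S.Cᵀ * P * S.D = (S.gainK P)ᵀ * S.weight P := by
      have := congrArg transpose (weight_mul_gainK hR hP)
      rw [transpose_mul, hW.eq] at this
      rw [this]
      simp [transpose_mul, hs.eq, Matrix.mul_assoc]
    rw [this, Matrix.mul_assoc, ← gainK, Matrix.mul_assoc]
  rw [e1, e2] at h2
  rw [riccati, ham_expand hs, ← weight_mul_gainK hR hP, ← hg]
  simp only [transpose_mul, transpose_smul, hW.eq, Matrix.mul_assoc, Matrix.smul_mul,
    Matrix.mul_smul]
  rw [← h2]
  simp only [Matrix.mul_assoc]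
  abel

lemma posSemidef_transpose_mul_mul {ι κ : Type*} [Fintype ι] [Fintype κ] {W : Matrix κ κ ℝ}
    (hW : W.PosSemidef) (X : Matrix κ ι ℝ) : (Xᵀ * W * X).PosSemidef := by
  have := hW.conjTranspose_mul_mul_same X
  rwa [conjTranspose_eq_transpose_of_trivial] at this

lemma posSemidef_transpose_mul_self {ι κ : Type*} [Fintype ι] [Fintype κ]
    (X : Matrix κ ι ℝ) : (Xᵀ * X).PosSemidef := by
  have := posSemidef_conjTranspose_mul_self X
  rwa [conjTranspose_eq_transpose_of_trivial] at this

/-- The maximum principle in Hamiltonian form: a larger Hamiltonian under a common stable pair of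
gains means a smaller matrix. -/
lemma LStable.posSemidef_sub {K L} (h : S.LStable K L) {P P' N : Matrix (Fin n) (Fin n) ℝ}
    (hP : P.IsSymm) (hP' : P'.IsSymm) (hN : N.PosSemidef)
    (hham : S.ham K L K L P' = S.ham K L K L P + N) : (P - P').PosSemidef := by
  refine LyapStable.posSemidef h (hP.sub hP') ?_
  rw [lyapunov, ← ham_sub, hham]
  simpa using hN

end Data

/-! ### One step of policy iteration. -/

namespace Data

variable {n m₁ m₂ : ℕ} {S : Data n m₁ m₂}

lemma ham_eq_add (hR : S.R.PosDef) (hγ : 0 < S.γ) {P : Matrix (Fin n) (Fin n) ℝ}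
    (hP : P.PosSemidef) (K : Matrix (Fin m₁) (Fin n) ℝ) (L : Matrix (Fin m₂) (Fin n) ℝ) :
    S.ham K L K L P = S.ham (S.gainK P) L (S.gainK P) L P
      + (K - S.gainK P)ᵀ * S.weight P * (K - S.gainK P) := by
  rw [ham_eq hR hγ hP K, ham_eq hR hγ hP (S.gainK P)]
  simp only [sub_self, Matrix.mul_zero]
  abel

lemma IsH2Solution.ham_eq_zero {L P} (h : S.IsH2Solution L P) :
    S.ham (S.gainK P) L (S.gainK P) L P = 0 := (lyapEq_iff.1 h.2.1).2

lemma IsH2Solution.ham_eq (hR : S.R.PosDef) (hγ : 0 < S.γ) {L P} (h : S.IsH2Solution L P) (K) :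
    S.ham K L K L P = (K - S.gainK P)ᵀ * S.weight P * (K - S.gainK P) := by
  rw [ham_eq_add hR hγ h.1, h.ham_eq_zero, zero_add]

/-- The stabilizing solution lies below the value of every stabilizing gain. -/
lemma IsH2Solution.posSemidef_sub (hR : S.R.PosDef) (hγ : 0 < S.γ) {L PL}
    (h : S.IsH2Solution L PL) {K P} (hK : S.LStable K L) (hP : S.LyapEq K L P) :
    (P - PL).PosSemidef := by
  rw [lyapEq_iff] at hP
  refine hK.posSemidef_sub hP.1 (isSymm_of_posSemidef h.1) (posSemidef_transpose_mul_mul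
    (weight_posDef hR h.1).posSemidef (K - S.gainK PL)) ?_
  rw [hP.2, zero_add, h.ham_eq hR hγ]

/-- Each solution is itself the value of a stabilizing gain, so each lies below the other. -/
lemma IsH2Solution.unique (hR : S.R.PosDef) (hγ : 0 < S.γ) {L P P'}
    (h : S.IsH2Solution L P) (h' : S.IsH2Solution L P') : P = P' :=
  eq_of_posSemidef_sub (h'.posSemidef_sub hR hγ h.2.2.lStable h.2.1)
    (h.posSemidef_sub hR hγ h'.2.2.lStable h'.2.1)

lemma LyapEq.unique {K L P P'} (hK : S.LStable K L) (hP : S.LyapEq K L P)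
    (hP' : S.LyapEq K L P') : P = P' := by
  rw [lyapEq_iff] at hP hP'
  refine eq_of_posSemidef_sub (hK.posSemidef_sub hP.1 hP'.1 PosSemidef.zero ?_)
    (hK.posSemidef_sub hP'.1 hP.1 PosSemidef.zero ?_) <;> rw [hP.2, hP'.2, add_zero]

lemma posSemidef_of_sub {P P' : Matrix (Fin n) (Fin n) ℝ} (h : (P - P').PosSemidef)
    (h' : P'.PosSemidef) : P.PosSemidef := by
  simpa using h.add h'

/-- The improved gain is stabilizing. -/
lemma IsH2Solution.lStable_gainK (hR : S.R.PosDef) (hγ : 0 < S.γ) {L PL}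
    (h : S.IsH2Solution L PL) {K P} (hK : S.LStable K L) (hP : S.LyapEq K L P) :
    S.LStable (S.gainK P) L := by
  have hsub := h.posSemidef_sub hR hγ hK hP
  have hPp := posSemidef_of_sub hsub h.1
  have hst : S.LStable (S.gainK PL) L := h.2.2.lStable
  have e1 : S.drift (S.gainK P) L =
      S.drift (S.gainK PL) L + (-S.B) * (S.gainK P - S.gainK PL) := by
    simp only [drift, Matrix.neg_mul, Matrix.mul_sub]; abel
  have e2 : S.diffusion (S.gainK P) =
      S.diffusion (S.gainK PL) + (-S.D) * (S.gainK P - S.gainK PL) := by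
    simp only [diffusion, Matrix.neg_mul, Matrix.mul_sub]; abel
  have h0 := (lyapEq_iff.1 hP).2
  rw [ham_eq_add hR hγ hPp] at h0
  have hd := ham_sub (S := S) (S.gainK P) L (S.gainK P) L P PL
  rw [h.ham_eq hR hγ, eq_neg_of_add_eq_zero_left h0] at hd
  rw [LStable, e1, e2]
  -- The change of gain from the optimal one is the perturbation, and `P - PL` is the supersolution
  -- that sees it. What remains of its Lyapunov inequality is exactly the square in `K - S.gainK P`.
  refine LyapStable.of_detectable hst (-S.B) (-S.D) _ (weight_posDef hR h.1) hsub ?_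
  rw [← e1, ← e2, lyapunov, ← hd]
  simpa using posSemidef_transpose_mul_mul (weight_posDef hR hPp).posSemidef (K - S.gainK P)

/-- The diffusion term has nonnegative trace and is dropped, so only the drift enters the
contraction rate. -/
lemma trace_lyapunov_ge {F H X : Matrix (Fin n) (Fin n) ℝ} (hX : X.PosSemidef) :
    -(2 * entrySum F * X.trace) ≤ (lyapunov F H X).trace := by
  have h1 := (posSemidef_transpose_mul_mul hX H).trace_nonneg
  have h2 : (Fᵀ * X).trace = (F * X).trace := by
    rw [← trace_transpose, transpose_mul, transpose_transpose, (isSymm_of_posSemidef hX).eq,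
      trace_mul_comm]
  have h3 := (abs_le.1 (abs_trace_mul_le F hX)).1
  rw [lyapunov, mixedLyap, trace_add, trace_add, h2, trace_mul_comm X F]
  linarith

/-- One step of policy iteration contracts the distance to the stabilizing solution. -/
lemma IsH2Solution.trace_contract (hR : S.R.PosDef) (hγ : 0 < S.γ) {L PL}
    (h : S.IsH2Solution L PL) {K P P'} (hK : S.LStable K L) (hP : S.LyapEq K L P)
    (hP' : S.LyapEq (S.gainK P) L P') {U : Matrix (Fin n) (Fin n) ℝ} (hU : U.PosSemidef)
    (hUL : (-(lyapunov (S.drift (S.gainK PL) L) (S.diffusion (S.gainK PL)) U) - 1).PosSemidef) :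
    0 ≤ (P - P').trace ∧
    (P - PL).trace ≤ U.trace * (2 * entrySum (S.drift (S.gainK P) L) * (P - P').trace) := by
  have hsub := h.posSemidef_sub hR hγ hK hP
  have hPp := posSemidef_of_sub hsub h.1
  have hPs := (lyapEq_iff.1 hP).1
  have hK' := h.lStable_gainK hR hγ hK hP
  set E := (K - S.gainK P)ᵀ * S.weight P * (K - S.gainK P) with hE
  have hEp : E.PosSemidef := posSemidef_transpose_mul_mul (weight_posDef hR hPp).posSemidef _
  have h0 : S.ham (S.gainK P) L (S.gainK P) L P = -E := by
    have := (lyapEq_iff.1 hP).2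
    rw [ham_eq_add hR hγ hPp] at this
    exact eq_neg_of_add_eq_zero_left this
  have hd' : (P - P').PosSemidef := by
    refine hK'.posSemidef_sub hPs hP'.1 hEp ?_
    rw [h0, (lyapEq_iff.1 hP').2]; abel
  have hlow : E.trace ≤ 2 * entrySum (S.drift (S.gainK P) L) * (P - P').trace := by
    have := trace_lyapunov_ge (F := S.drift (S.gainK P) L) (H := S.diffusion (S.gainK P)) hd'
    rw [lyapunov, ← ham_sub, h0, (lyapEq_iff.1 hP').2, sub_zero, trace_neg] at this
    linarith
  refine ⟨hd'.trace_nonneg, ?_⟩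
  have hst : S.LStable (S.gainK PL) L := h.2.2.lStable
  set W := (S.gainK PL - S.gainK P)ᵀ * S.weight P * (S.gainK PL - S.gainK P) with hW
  have hWp : W.PosSemidef := posSemidef_transpose_mul_mul (weight_posDef hR hPp).posSemidef _
  have hX : lyapunov (S.drift (S.gainK PL) L) (S.diffusion (S.gainK PL)) (P - PL) = -E + W := by
    rw [lyapunov, ← ham_sub, h.ham_eq_zero, sub_zero, ham_eq_add hR hγ hPp, h0]
  -- The image of `U` is at most `-1` and `E ≤ Tr(E) 1`; the additional square `W` has the
  -- favourable sign.
  have hup : (E.trace • U - (P - PL)).PosSemidef := by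
    refine LyapStable.posSemidef hst
      ((isSymm_of_posSemidef (hU.smul hEp.trace_nonneg)).sub (isSymm_of_posSemidef hsub)) ?_
    have hsum := ((hUL.smul hEp.trace_nonneg).add (posSemidef_trace_smul_one_sub hEp)).add hWp
    convert hsum using 1
    rw [lyapunov, mixedLyap_sub, mixedLyap_smul, ← lyapunov, ← lyapunov, hX, smul_sub, smul_neg]
    abel
  have := hup.trace_nonneg
  rw [trace_sub, trace_smul, smul_eq_mul] at this
  calc (P - PL).trace ≤ E.trace * U.trace := by linarith
    _ = U.trace * E.trace := mul_comm _ _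
    _ ≤ _ := mul_le_mul_of_nonneg_left hlow hU.trace_nonneg

end Data

/-- Normalizing the margin to `1` makes the trace of the certificate the quantitative measure of
stability. -/
lemma exists_pos_one_le_lyapunov {n : ℕ} {F H : Matrix (Fin n) (Fin n) ℝ} (h : LyapStable F H) :
    ∃ U : Matrix (Fin n) (Fin n) ℝ, U.PosSemidef ∧ (-(lyapunov F H U) - 1).PosSemidef := by
  obtain ⟨U, hU, hUL⟩ := h
  obtain ⟨r, hr, hrU⟩ := exists_pos_le_bil hUL
  have hUs := isSymm_of_posSemidef hU.posSemidef
  refine ⟨r⁻¹ • U, hU.posSemidef.smul (inv_nonneg.2 hr.le), posSemidef_iff_bil.2 ⟨?_, fun x => ?_⟩⟩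
  · exact (lyapunov_isSymm _ _ (IsSymm.smul hUs _)).neg.sub isSymm_one
  · have h1 := hrU x
    rw [bil_neg] at h1
    have h2 : x ⬝ᵥ x ≤ r⁻¹ * -bil (lyapunov F H U) x x := by
      rw [inv_mul_eq_div, le_div_iff₀ hr]; linarith
    have h3 : bil (1 : Matrix (Fin n) (Fin n) ℝ) x x = x ⬝ᵥ x := bil_one x x
    rw [bil_sub, bil_neg, lyapunov, mixedLyap_smul, ← lyapunov, bil_smul, h3]
    linarith

/-- The positive semidefinite matrices of bounded trace. -/
def psdBall (n : ℕ) (τ : ℝ) : Set (Matrix (Fin n) (Fin n) ℝ) := {P | P.PosSemidef ∧ P.trace ≤ τ}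

/-- The entries are bounded by the trace, and the conditions are closed. -/
lemma isCompact_psdBall (n : ℕ) (τ : ℝ) : IsCompact (psdBall n τ) := by
  have hK : IsCompact (X := Matrix (Fin n) (Fin n) ℝ)
      (Set.Icc (α := Fin n → Fin n → ℝ) (fun _ _ => -τ) (fun _ _ => τ)) :=
    isCompact_Icc (α := Fin n → Fin n → ℝ)
  refine hK.of_isClosed_subset ?_ ?_
  · have : psdBall n τ = {P | Pᵀ = P} ∩ (⋂ x : Fin n → ℝ, {P | 0 ≤ bil P x x})
        ∩ {P | P.trace ≤ τ} := by
      ext P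
      simp [psdBall, posSemidef_iff_bil, IsSymm]
    rw [this]
    refine ((isClosed_eq (by fun_prop) continuous_id).inter (isClosed_iInter fun x =>
      isClosed_le continuous_const ?_)).inter (isClosed_le (by fun_prop) continuous_const)
    unfold bil; fun_prop
  · intro P hP
    have h := fun i j => abs_le.1 ((abs_apply_le_trace hP.1 i j).trans hP.2)
    exact ⟨fun i j => (h i j).1, fun i j => (h i j).2⟩

lemma continuousAt_matrix_mul {X ι κ μ : Type*} [TopologicalSpace X] [Fintype κ]
    {f : X → Matrix ι κ ℝ} {g : X → Matrix κ μ ℝ} {x : X} (hf : ContinuousAt f x)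
    (hg : ContinuousAt g x) : ContinuousAt (fun y => f y * g y) x :=
  (continuous_fst.matrix_mul continuous_snd).continuousAt.comp' (hf.prodMk hg)

namespace Data

variable {n m₁ m₂ : ℕ} {S : Data n m₁ m₂}

lemma continuousAt_gainK (hR : S.R.PosDef) {P : Matrix (Fin n) (Fin n) ℝ} (hP : P.PosSemidef) :
    ContinuousAt S.gainK P := by
  have hdet : (S.weight P).det ≠ 0 :=
    ((isUnit_iff_isUnit_det _).1 (weight_posDef hR hP).isUnit).ne_zero
  have hw : Continuous S.weight := by unfold weight; fun_prop
  have : S.gainK = fun P : Matrix (Fin n) (Fin n) ℝ => ((S.weight P).det⁻¹ • (S.weight P).adjugate) *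
      (S.Bᵀ * P + S.Dᵀ * P * S.C) := by
    funext P
    rw [gainK, ← weight, inv_def, Ring.inverse_eq_inv']
  rw [this]
  have h1 : ContinuousAt (fun P => (S.weight P).det⁻¹) P :=
    (hw.matrix_det.continuousAt).inv₀ hdet
  have h2 : ContinuousAt (fun P => (S.weight P).det⁻¹ • (S.weight P).adjugate) P :=
    h1.smul hw.matrix_adjugate.continuousAt
  have h3 : Continuous (fun P : Matrix (Fin n) (Fin n) ℝ => S.Bᵀ * P + S.Dᵀ * P * S.C) := by fun_prop
  exact continuousAt_matrix_mul h2 h3.continuousAt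

lemma continuous_gainL : Continuous S.gainL := by
  unfold gainL; fun_prop

/-- Along the outer loop the Riccati residual is thus a square; its nonnegativity drives the
monotonicity. -/
lemma IsH2Solution.riccati_eq (hR : S.R.PosDef) (hγ : 0 < S.γ) {L P}
    (h : S.IsH2Solution L P) :
    S.riccati P = S.γ ^ 2 • ((L - S.gainL P)ᵀ * (L - S.gainL P)) := by
  have h1 := h.ham_eq_zero
  rw [Data.ham_eq hR hγ h.1] at h1
  simpa [sub_eq_zero] using h1

lemma riccati_zero : S.riccati 0 = S.Q := by
  simp [riccati, gainK, gainL, ham, mixedLyap]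

/-! ### Monotonicity, upper bound and gap estimate for the outer loop. -/

section OuterLoop

variable {P : ℕ → Matrix (Fin n) (Fin n) ℝ} {L : ℕ → Matrix (Fin m₂) (Fin n) ℝ}

lemma IsOuterLoop.posSemidef (h : S.IsOuterLoop P L) (k : ℕ) : (P k).PosSemidef := by
  cases k with
  | zero => rw [h.init]; exact PosSemidef.zero
  | succ k => exact (h.step k).1

lemma IsOuterLoop.riccati_posSemidef (hQ : S.Q.PosSemidef) (hR : S.R.PosDef) (hγ : 0 < S.γ)
    (h : S.IsOuterLoop P L) (k : ℕ) : (S.riccati (P k)).PosSemidef := by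
  cases k with
  | zero => rw [h.init, riccati_zero]; exact hQ
  | succ k =>
    rw [(h.step k).riccati_eq hR hγ]
    exact (posSemidef_transpose_mul_self _).smul (by positivity)

lemma IsOuterLoop.ham_eq (hR : S.R.PosDef) (hγ : 0 < S.γ) (h : S.IsOuterLoop P L) (k : ℕ)
    (K₁ K₂ L₂) : S.ham K₁ (L k) K₂ L₂ (P k) = S.riccati (P k)
      + (K₁ - S.gainK (P k))ᵀ * S.weight (P k) * (K₂ - S.gainK (P k)) := by
  rw [Data.ham_eq hR hγ (h.posSemidef k), h.gain k]
  simp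

/-- As `L k` is the disturbance gain of `P k`, the disturbance square vanishes and the Hamiltonian
at `P k` is a nonnegative residual plus a control square. -/
lemma IsOuterLoop.mono (hQ : S.Q.PosSemidef) (hR : S.R.PosDef) (hγ : 0 < S.γ)
    (h : S.IsOuterLoop P L) (k : ℕ) : (P (k + 1) - P k).PosSemidef := by
  refine (h.step k).2.2.lStable.posSemidef_sub (isSymm_of_posSemidef (h.posSemidef _))
    (isSymm_of_posSemidef (h.posSemidef _)) ((h.riccati_posSemidef hQ hR hγ k).add
      (posSemidef_transpose_mul_mul (weight_posDef hR (h.posSemidef k)).posSemidef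
        (S.gainK (P (k + 1)) - S.gainK (P k)))) ?_
  rw [(h.step k).ham_eq_zero, zero_add, h.ham_eq hR hγ]

lemma IsOuterLoop.le_gameSolution (hQ : S.Q.PosSemidef) (hR : S.R.PosDef) (hγ : 0 < S.γ)
    (h : S.IsOuterLoop P L) {Pstar} (hs : S.IsGameSolution Pstar) (k : ℕ) :
    (Pstar - P k).PosSemidef := by
  induction k with
  | zero => rw [h.init, sub_zero]; exact hs.1
  | succ k ih =>
    have hst : S.LStable (S.gainK Pstar) (S.gainL Pstar) := hs.2.2.lStable
    have hsq := fun k => posSemidef_transpose_mul_mul (weight_posDef hR (h.posSemidef k)).posSemidef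
        (S.gainK Pstar - S.gainK (P k))
    have hstar : S.ham (S.gainK Pstar) (L k) (S.gainK Pstar) (L k) Pstar =
        -(S.γ ^ 2 • ((L k - S.gainL Pstar)ᵀ * (L k - S.gainL Pstar))) := by
      rw [Data.ham_eq hR hγ hs.1, hs.riccati_eq_zero hR hγ]
      simp
    have e1 : S.drift (S.gainK Pstar) (L k) = S.drift (S.gainK Pstar) (S.gainL Pstar)
        + S.G * (L k - S.gainL Pstar) := by
      simp only [drift, Matrix.mul_sub]; abel
    have e2 : S.diffusion (S.gainK Pstar) = S.diffusion (S.gainK Pstar)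
        + (0 : Matrix (Fin n) (Fin m₂) ℝ) * (L k - S.gainL Pstar) := by
      simp
    -- Replacing the worst disturbance gain by `L k` keeps stability: `Pstar - P k`, nonnegative by
    -- induction, is the supersolution that sees the change of gain with weight `γ²`.
    have hstk : S.LStable (S.gainK Pstar) (L k) := by
      rw [LStable, e1, e2]
      refine LyapStable.of_detectable hst S.G 0 _
        (R := S.γ ^ 2 • (1 : Matrix (Fin m₂) (Fin m₂) ℝ)) (PosDef.one.smul (by positivity)) ih ?_
      rw [← e1, ← e2, lyapunov, ← ham_sub, hstar, h.ham_eq hR hγ]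
      have := (h.riccati_posSemidef hQ hR hγ k).add (hsq k)
      convert this using 1
      simp
    have hN := (hsq (k + 1)).add ((posSemidef_transpose_mul_self (L k - S.gainL Pstar)).smul
      (show (0 : ℝ) ≤ S.γ ^ 2 by positivity))
    refine hstk.posSemidef_sub (isSymm_of_posSemidef hs.1)
      (isSymm_of_posSemidef (h.posSemidef _)) hN ?_
    rw [hstar, (h.step k).ham_eq hR hγ]
    abel

/-- This is why a rate obtained from one outer loop depends only on the data. -/
lemma IsOuterLoop.unique (hR : S.R.PosDef) (hγ : 0 < S.γ) (h : S.IsOuterLoop P L) {P' L'}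
    (h' : S.IsOuterLoop P' L') (k : ℕ) : P k = P' k := by
  induction k with
  | zero => rw [h.init, h'.init]
  | succ k ih =>
    have h1 := h.step k
    have h2 := h'.step k
    rw [h.gain, ih] at h1
    rw [h'.gain] at h2
    exact h1.unique hR hγ h2

lemma IsOuterLoop.mem_psdBall (hQ : S.Q.PosSemidef) (hR : S.R.PosDef) (hγ : 0 < S.γ)
    (h : S.IsOuterLoop P L) {Pstar} (hs : S.IsGameSolution Pstar) (k : ℕ) :
    P k ∈ psdBall n Pstar.trace := by
  refine ⟨h.posSemidef k, ?_⟩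
  have := (h.le_gameSolution hQ hR hγ hs k).trace_nonneg
  rw [trace_sub] at this
  linarith

lemma exists_bound_on_psdBall {f : Matrix (Fin n) (Fin n) ℝ × Matrix (Fin n) (Fin n) ℝ → ℝ} {τ : ℝ}
    (hf : ∀ P P' : Matrix (Fin n) (Fin n) ℝ, P.PosSemidef → P'.PosSemidef → ContinuousAt f (P, P')) :
    ∃ c : ℝ, ∀ P ∈ psdBall n τ, ∀ P' ∈ psdBall n τ, f (P, P') ≤ c := by
  have hc := ((isCompact_psdBall n τ).prod (isCompact_psdBall n τ))
  obtain ⟨c, hc⟩ := hc.bddAbove_image (f := f)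
    fun p hp => (hf p.1 p.2 hp.1.1 hp.2.1).continuousWithinAt
  exact ⟨c, fun P hP P' hP' => hc ⟨(P, P'), ⟨hP, hP'⟩, rfl⟩⟩

/-- The distance to the game solution is controlled by the last increment. -/
lemma IsOuterLoop.exists_trace_le (hQ : S.Q.PosSemidef) (hR : S.R.PosDef) (hγ : 0 < S.γ)
    (h : S.IsOuterLoop P L) {Pstar} (hs : S.IsGameSolution Pstar) :
    ∃ c : ℝ, 0 ≤ c ∧ ∀ k : ℕ, ∀ a : ℝ, 0 < a →
      (Pstar - P (k + 1)).trace ≤ a * (P (k + 2) - P (k + 1)).trace + c / a := by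
  have hst : S.LStable (S.gainK Pstar) (S.gainL Pstar) := hs.2.2.lStable
  obtain ⟨U, hU, hUL⟩ := exists_pos_one_le_lyapunov hst
  -- A bound, uniform in `k`, on the squares in `y` left over when the cross terms of the block
  -- inequality are completed.
  obtain ⟨c, hc⟩ := exists_bound_on_psdBall (n := n) (τ := Pstar.trace)
    (f := fun p => S.γ ^ 2 * entrySum ((S.gainL p.1 - S.gainL p.2)ᵀ * (S.gainL p.1 - S.gainL p.2))
      + entrySum ((S.gainK Pstar - S.gainK p.2)ᵀ * S.weight p.2 * (S.gainK Pstar - S.gainK p.2)))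
    (fun Q Q' _ hQ' => by
      have hK : ContinuousAt (fun p : Matrix (Fin n) (Fin n) ℝ × Matrix (Fin n) (Fin n) ℝ =>
          S.gainK Pstar - S.gainK p.2) (Q, Q') :=
        continuousAt_const.sub ((continuousAt_gainK hR hQ').comp' continuousAt_snd)
      have hw : Continuous S.weight := by unfold weight; fun_prop
      have hW : ContinuousAt (fun p : Matrix (Fin n) (Fin n) ℝ × Matrix (Fin n) (Fin n) ℝ =>
          S.weight p.2) (Q, Q') := (hw.comp continuous_snd).continuousAt
      have hL : Continuous (fun p : Matrix (Fin n) (Fin n) ℝ × Matrix (Fin n) (Fin n) ℝ =>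
          S.gainL p.1 - S.gainL p.2) :=
        (continuous_gainL.comp continuous_fst).sub (continuous_gainL.comp continuous_snd)
      have hKt : ContinuousAt (fun p : Matrix (Fin n) (Fin n) ℝ × Matrix (Fin n) (Fin n) ℝ =>
          (S.gainK Pstar - S.gainK p.2)ᵀ) (Q, Q') :=
        (continuous_id.matrix_transpose.continuousAt).comp' hK
      have h1 : Continuous (fun p : Matrix (Fin n) (Fin n) ℝ × Matrix (Fin n) (Fin n) ℝ =>
          S.γ ^ 2 * entrySum ((S.gainL p.1 - S.gainL p.2)ᵀ * (S.gainL p.1 - S.gainL p.2))) :=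
        continuous_const.mul (continuous_entrySum.comp (hL.matrix_transpose.matrix_mul hL))
      exact h1.continuousAt.add
        (continuous_entrySum.continuousAt.comp' (continuousAt_matrix_mul (continuousAt_matrix_mul hKt hW) hK)))
  have hc0 : 0 ≤ max c 0 := le_max_right _ _
  refine ⟨max c 0 * U.trace, mul_nonneg hc0 hU.trace_nonneg, fun k a ha => ?_⟩
  have hck := (hc _ (h.mem_psdBall hQ hR hγ hs k) _ (h.mem_psdBall hQ hR hγ hs (k + 1))).trans
    (le_max_left c 0)
  simp only [← h.gain] at hck
  set d := max c 0
  set W := S.weight (P (k + 1)) with hWdef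
  have hWp : W.PosSemidef := (weight_posDef hR (h.posSemidef (k + 1))).posSemidef
  set dL := L k - L (k + 1) with hdL
  set dK := S.gainK (P (k + 2)) - S.gainK (P (k + 1)) with hdK
  set Γ := S.gainK Pstar - S.gainK (P (k + 1)) with hΓ
  have hric : S.riccati (P (k + 1)) = S.γ ^ 2 • (dLᵀ * dL) := by
    rw [(h.step k).riccati_eq hR hγ, ← h.gain]
  have hlyap : lyapunov (S.drift (S.gainK (P (k + 2))) (L (k + 1)))
      (S.diffusion (S.gainK (P (k + 2)))) (P (k + 2) - P (k + 1)) =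
      -(S.γ ^ 2 • (dLᵀ * dL) + dKᵀ * W * dK) := by
    rw [lyapunov, ← ham_sub, (h.step (k + 1)).ham_eq_zero, h.ham_eq hR hγ, hric, zero_sub]
  have hmix : mixedLyap (S.drift (S.gainK (P (k + 2))) (L (k + 1)))
      (S.diffusion (S.gainK (P (k + 2)))) (S.drift (S.gainK Pstar) (S.gainL Pstar))
      (S.diffusion (S.gainK Pstar)) (Pstar - P (k + 1)) =
      -(S.γ ^ 2 • (dLᵀ * dL) + dKᵀ * W * Γ) := by
    -- The second pair consists of the gains of `Pstar`, so both polarised squares vanish whatever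
    -- the first pair is.
    have : S.ham (S.gainK (P (k + 2))) (L (k + 1)) (S.gainK Pstar) (S.gainL Pstar) Pstar = 0 := by
      rw [Data.ham_eq hR hγ hs.1, hs.riccati_eq_zero hR hγ]
      simp
    rw [← ham_sub, this, h.ham_eq hR hγ, hric, zero_sub]
  have hUs := isSymm_of_posSemidef hU
  have hinc := h.mono hQ hR hγ (k + 1)
  have hstk : S.LStable (S.gainK (P (k + 2))) (L (k + 1)) := (h.step (k + 1)).2.2.lStable
  have hblock := LyapStable.bil_block_nonneg hstk hst
    (X := P (k + 2) - P (k + 1)) (Y := d • U) (Pstar - P (k + 1))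
    (isSymm_of_posSemidef hinc) (IsSymm.smul hUs d) (by
      intro x y
      rw [hlyap, hmix, lyapunov, mixedLyap_smul, ← lyapunov]
      simp only [bil_neg, bil_add, bil_smul]
      have e1 : ∀ u v, bil (dLᵀ * dL) u v = (dL *ᵥ u) ⬝ᵥ (dL *ᵥ v) := fun u v => by
        rw [bil_transpose_mul]; rfl
      have e2 : ∀ (M N : Matrix (Fin m₁) (Fin n) ℝ) u v,
          bil (Mᵀ * W * N) u v = bil W (M *ᵥ u) (N *ᵥ v) := fun M N u v => by
        rw [bil_mul _ N, bil_transpose_mul]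
      have h1 := bil_nonneg hUL y
      have h2 : bil (1 : Matrix (Fin n) (Fin n) ℝ) y y = y ⬝ᵥ y := bil_one y y
      rw [bil_sub, bil_neg, h2] at h1
      have h3 := bil_le (dLᵀ * dL) y
      have h4 := bil_le (Γᵀ * W * Γ) y
      have h5 := dotProduct_self_nonneg' (dL *ᵥ x + dL *ᵥ y)
      have h6 := bil_nonneg hWp (dK *ᵥ x + Γ *ᵥ y)
      simp only [dotProduct_add, add_dotProduct] at h5
      simp only [bil_add_left, bil_add_right] at h6
      rw [dotProduct_comm (dL *ᵥ y) (dL *ᵥ x)] at h5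
      have hsw : bil W (Γ *ᵥ y) (dK *ᵥ x) = bil W (dK *ᵥ x) (Γ *ᵥ y) := by
        rw [bil_comm, (isSymm_of_posSemidef hWp).eq]
      rw [hsw] at h6
      rw [e1] at h3
      rw [e2] at h4
      rw [e1, e1, e2, e2]
      have h7 := mul_le_mul_of_nonneg_right hck (dotProduct_self_nonneg' y)
      have h8 : d * bil (lyapunov (S.drift (S.gainK Pstar) (S.gainL Pstar))
          (S.diffusion (S.gainK Pstar)) U) y y ≤ d * -(y ⬝ᵥ y) :=
        mul_le_mul_of_nonneg_left (by linarith) hc0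
      have h9 := mul_nonneg (show (0 : ℝ) ≤ S.γ ^ 2 by positivity) h5
      have h10 := mul_le_mul_of_nonneg_left h3 (show (0 : ℝ) ≤ S.γ ^ 2 by positivity)
      linarith)
  -- The block form at `(a x, -x)`, divided by `2 a`. The gap enters linearly through the
  -- off-diagonal block, so the weight `a` is free.
  have hZ : (((a / 2) • (P (k + 2) - P (k + 1)) + (d / (2 * a)) • U)
      - (Pstar - P (k + 1))).PosSemidef := by
    refine posSemidef_iff_bil.2 ⟨?_, fun x => ?_⟩
    · exact ((IsSymm.smul (isSymm_of_posSemidef hinc) _).add (IsSymm.smul hUs _)).sub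
        (isSymm_of_posSemidef (h.le_gameSolution hQ hR hγ hs _))
    · have h1 := hblock (a • x) ((-1 : ℝ) • x)
      simp only [bil_smul_left, bil_smul_right, bil_smul] at h1
      simp only [bil_sub _ (Pstar - P (k + 1)), bil_add, bil_smul]
      have h2 : 0 ≤ (1 / (2 * a)) * (a * (a * bil (P (k + 2) - P (k + 1)) x x) + 2 * (a * (-1 *
        bil (Pstar - P (k + 1)) x x)) + -1 * (-1 * (d * bil U x x))) :=
        mul_nonneg (by positivity) (le_of_le_of_eq h1 (by ring))
      refine le_of_le_of_eq h2 ?_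
      field_simp
      ring
  have h1 := hZ.trace_nonneg
  rw [trace_sub, trace_add, trace_smul, trace_smul, smul_eq_mul, smul_eq_mul] at h1
  have h2 : d / (2 * a) * U.trace = d * U.trace / a / 2 := by field_simp
  have h3 : 0 ≤ d * U.trace / a := div_nonneg (mul_nonneg hc0 hU.trace_nonneg) ha.le
  have h4 : 0 ≤ a * (P (k + 2) - P (k + 1)).trace := mul_nonneg ha.le hinc.trace_nonneg
  linarith

end OuterLoop

end Data

/-! ### Convergence of the outer loop and the uniform rate. -/

namespace Data

variable {n m₁ m₂ : ℕ} {S : Data n m₁ m₂}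
variable {P : ℕ → Matrix (Fin n) (Fin n) ℝ} {L : ℕ → Matrix (Fin m₂) (Fin n) ℝ}

lemma IsOuterLoop.tendsto_trace (hQ : S.Q.PosSemidef) (hR : S.R.PosDef) (hγ : 0 < S.γ)
    (h : S.IsOuterLoop P L) {Pstar} (hs : S.IsGameSolution Pstar) :
    Tendsto (fun k => (Pstar - P (k + 1)).trace) atTop (𝓝 0) := by
  obtain ⟨c, hc, hb⟩ := h.exists_trace_le hQ hR hγ hs
  have hmono : Monotone fun k => (P k).trace := monotone_nat_of_le_succ fun k => by
    have := (h.mono hQ hR hγ k).trace_nonneg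
    rw [trace_sub] at this
    linarith
  have hbdd : BddAbove (Set.range fun k => (P k).trace) :=
    ⟨Pstar.trace, by rintro _ ⟨k, rfl⟩; exact (h.mem_psdBall hQ hR hγ hs k).2⟩
  have hlim := tendsto_atTop_ciSup hmono hbdd
  have hinc : Tendsto (fun k => (P (k + 2) - P (k + 1)).trace) atTop (𝓝 0) := by
    have := (hlim.comp (tendsto_add_atTop_nat 2)).sub (hlim.comp (tendsto_add_atTop_nat 1))
    rw [sub_self] at this
    exact this.congr fun k => (trace_sub _ _).symm
  rw [Metric.tendsto_atTop]
  intro ε hε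
  -- First `a` makes `c / a` less than `ε / 2`; then, with `a` fixed, the increments of the
  -- convergent traces handle the other term.
  set a := 2 * c / ε + 1 with ha
  have ha0 : 0 < a := by positivity
  have hca : c / a < ε / 2 := by
    rw [div_lt_iff₀ ha0, ha]
    have : ε / 2 * (2 * c / ε + 1) = c + ε / 2 := by field_simp
    rw [this]; linarith
  obtain ⟨N, hN⟩ := (Metric.tendsto_atTop.1 hinc) (ε / 2 / a) (by positivity)
  refine ⟨N, fun k hk => ?_⟩
  have h1 := hN k hk
  rw [Real.dist_eq, sub_zero, lt_div_iff₀ ha0] at h1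
  have h2 := hb k a ha0
  have h3 : a * (P (k + 2) - P (k + 1)).trace ≤ |(P (k + 2) - P (k + 1)).trace| * a := by
    rw [mul_comm]; exact mul_le_mul_of_nonneg_right (le_abs_self _) ha0.le
  rw [Real.dist_eq, sub_zero, abs_of_nonneg (h.le_gameSolution hQ hR hγ hs _).trace_nonneg]
  linarith

/-- The outer loop converges to the stabilizing solution of the game. -/
lemma IsOuterLoop.tendsto (hQ : S.Q.PosSemidef) (hR : S.R.PosDef) (hγ : 0 < S.γ)
    (h : S.IsOuterLoop P L) {Pstar} (hs : S.IsGameSolution Pstar) :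
    Tendsto P atTop (𝓝 Pstar) := by
  rw [← tendsto_add_atTop_iff_nat 1]
  refine tendsto_pi_nhds.2 fun i => tendsto_pi_nhds.2 fun j => ?_
  rw [tendsto_iff_dist_tendsto_zero]
  refine squeeze_zero (fun _ => dist_nonneg) (fun k => ?_) (h.tendsto_trace hQ hR hγ hs)
  rw [dist_comm, Real.dist_eq]
  exact abs_apply_le_trace (h.le_gameSolution hQ hR hγ hs (k + 1)) i j

/-- The closed loops along the outer loop are uniformly stable. -/
lemma IsOuterLoop.exists_uniform (hQ : S.Q.PosSemidef) (hR : S.R.PosDef) (hγ : 0 < S.γ)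
    (h : S.IsOuterLoop P L) {Pstar} (hs : S.IsGameSolution Pstar) :
    ∃ u : ℝ, ∀ k, ∃ U : Matrix (Fin n) (Fin n) ℝ, U.PosSemidef ∧ U.trace ≤ u ∧
      (-(lyapunov (S.drift (S.gainK (P (k + 1))) (L k)) (S.diffusion (S.gainK (P (k + 1)))) U)
        - 1).PosSemidef := by
  have hst : S.LStable (S.gainK Pstar) (S.gainL Pstar) := hs.2.2.lStable
  obtain ⟨U, hU, hUL⟩ := exists_pos_one_le_lyapunov hst
  have hUs := isSymm_of_posSemidef hU
  have hlim := h.tendsto hQ hR hγ hs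
  have hK : Tendsto (fun k => S.gainK (P (k + 1))) atTop (𝓝 (S.gainK Pstar)) :=
    (continuousAt_gainK hR hs.1).tendsto.comp (hlim.comp (tendsto_add_atTop_nat 1))
  have hL : Tendsto L atTop (𝓝 (S.gainL Pstar)) := by
    have : L = fun k => S.gainL (P k) := funext h.gain
    rw [this]
    exact (continuous_gainL.tendsto _).comp hlim
  set M := fun q : Matrix (Fin m₁) (Fin n) ℝ × Matrix (Fin m₂) (Fin n) ℝ =>
    lyapunov (S.drift q.1 q.2) (S.diffusion q.1) U with hM
  have hMc : Continuous M := by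
    rw [hM]; unfold lyapunov mixedLyap drift diffusion; fun_prop
  have hconv : Tendsto (fun k => entrySum (M (S.gainK (P (k + 1)), L k)
      - M (S.gainK Pstar, S.gainL Pstar))) atTop (𝓝 0) := by
    have hc : Continuous fun q => entrySum (M q - M (S.gainK Pstar, S.gainL Pstar)) :=
      continuous_entrySum.comp (hMc.sub continuous_const)
    have h1 := (hc.tendsto (S.gainK Pstar, S.gainL Pstar)).comp (hK.prodMk_nhds hL)
    simpa [entrySum, Function.comp_def] using h1
  obtain ⟨N, hN⟩ := eventually_atTop.1 (hconv.eventually (gt_mem_nhds (show (0 : ℝ) < 1 / 2 by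
    norm_num)))
  choose V hV hVL using fun k => exists_pos_one_le_lyapunov (h.step k).2.2.lStable
  -- From `N` on the perturbation costs at most half of the margin, so `2 U` is a normalized
  -- certificate; the finitely many earlier indices use their own.
  refine ⟨((2 : ℝ) • U).trace + ∑ k ∈ Finset.range N, (V k).trace, fun k => ?_⟩
  have hU2 : ((2 : ℝ) • U).PosSemidef := hU.smul (by norm_num)
  have hsum := Finset.sum_nonneg (s := Finset.range N) fun k _ => (hV k).trace_nonneg
  by_cases hk : k < N
  · refine ⟨V k, hV k, ?_, hVL k⟩
    have := Finset.single_le_sum (f := fun k => (V k).trace) (fun k _ => (hV k).trace_nonneg)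
      (Finset.mem_range.2 hk)
    have := hU2.trace_nonneg
    linarith
  · refine ⟨(2 : ℝ) • U, hU2, by linarith, posSemidef_iff_bil.2
      ⟨(lyapunov_isSymm _ _ (IsSymm.smul hUs _)).neg.sub isSymm_one, fun x => ?_⟩⟩
    have h1 := bil_nonneg hUL x
    have h2 := bil_le (M (S.gainK (P (k + 1)), L k) - M (S.gainK Pstar, S.gainL Pstar)) x
    have h3 : bil (1 : Matrix (Fin n) (Fin n) ℝ) x x = x ⬝ᵥ x := bil_one x x
    have h4 := mul_le_mul_of_nonneg_right (hN k (not_lt.1 hk)).le (dotProduct_self_nonneg' x)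
    simp only [hM, bil_sub, bil_neg, h3] at h1 h2
    rw [bil_sub, bil_neg, lyapunov, mixedLyap_smul, ← lyapunov, bil_smul, h3]
    linarith

/-- For a fixed level, one step of policy iteration started from a gain in the sublevel set
contracts, at a rate that is uniform along the outer loop. -/
lemma IsOuterLoop.exists_rate (hQ : S.Q.PosSemidef) (hR : S.R.PosDef) (hγ : 0 < S.γ)
    (h : S.IsOuterLoop P L) {Pstar} (hs : S.IsGameSolution Pstar) (ρ : ℝ) (hρ : 0 < ρ) :
    ∃ α : ℝ, 0 < α ∧ α < 1 ∧ ∀ k, ∀ (K : Matrix (Fin m₁) (Fin n) ℝ)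
      (X X' : Matrix (Fin n) (Fin n) ℝ), S.LStable K (L k) → S.LyapEq K (L k) X →
        S.LyapEq (S.gainK X) (L k) X' → (X - P (k + 1)).trace ≤ ρ →
        (X' - P (k + 1)).trace ≤ α * (X - P (k + 1)).trace := by
  obtain ⟨u, hu⟩ := h.exists_uniform hQ hR hγ hs
  obtain ⟨f, hf⟩ := exists_bound_on_psdBall (n := n) (τ := Pstar.trace + ρ)
    (f := fun p => entrySum (S.drift (S.gainK p.1) (S.gainL p.2))) (fun Q Q' hQ' _ => by
      have hc : Continuous (fun q : Matrix (Fin m₁) (Fin n) ℝ × Matrix (Fin m₂) (Fin n) ℝ =>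
          entrySum (S.drift q.1 q.2)) := by
        refine continuous_entrySum.comp ?_
        unfold drift
        fun_prop
      have hp : ContinuousAt (fun p : Matrix (Fin n) (Fin n) ℝ × Matrix (Fin n) (Fin n) ℝ =>
          (S.gainK p.1, S.gainL p.2)) (Q, Q') :=
        ((continuousAt_gainK hR hQ').comp' continuousAt_fst).prodMk
          (continuous_gainL.continuousAt.comp' continuousAt_snd)
      have := (hc.tendsto (S.gainK Q, S.gainL Q')).comp hp.tendsto
      exact this)
  -- The product of the certificate bound and twice the drift bound; the maximum with `2` keeps `1 -
  -- θ⁻¹` positive.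
  set θ := max 2 (u * (2 * f)) with hθ
  have hθ2 : 2 ≤ θ := le_max_left _ _
  have hθ0 : 0 < θ := by linarith
  have hinv : θ⁻¹ ≤ 2⁻¹ := inv_anti₀ (by norm_num) hθ2
  have hinv0 : 0 < θ⁻¹ := inv_pos.2 hθ0
  refine ⟨1 - θ⁻¹, by norm_num at hinv; linarith, by linarith, fun k K X X' hK hX hX' hXρ => ?_⟩
  obtain ⟨U, hU, hUu, hUL⟩ := hu k
  have hsub := (h.step k).posSemidef_sub hR hγ hK hX
  have hXp := posSemidef_of_sub hsub (h.step k).1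
  obtain ⟨hd, hle⟩ := (h.step k).trace_contract hR hγ hK hX hX' hU hUL
  have hb := h.mem_psdBall hQ hR hγ hs k
  have hb' := h.mem_psdBall hQ hR hγ hs (k + 1)
  have hfX := hf X ⟨hXp, by rw [trace_sub] at hXρ; linarith [hb'.2]⟩ (P k) ⟨hb.1, by linarith [hb.2]⟩
  simp only [← h.gain] at hfX
  have he := entrySum_nonneg (S.drift (S.gainK X) (L k))
  have h1 : (X - P (k + 1)).trace ≤ θ * (X - X').trace := by
    refine hle.trans ?_
    rw [← mul_assoc]
    refine mul_le_mul_of_nonneg_right (le_trans ?_ (le_max_right _ _)) hd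
    exact mul_le_mul hUu (by linarith) (by positivity) (hU.trace_nonneg.trans hUu)
  have h2 : θ⁻¹ * (X - P (k + 1)).trace ≤ (X - X').trace := by
    rw [inv_mul_le_iff₀ hθ0]; exact h1
  simp only [trace_sub] at h2 ⊢
  linarith

end Data

end RobustMF

theorem theorem4 {n m₁ m₂ : ℕ} (S : RobustMF.Data n m₁ m₂)
    (hQ : S.Q.PosSemidef) (hR : S.R.PosDef) (hγ : 0 < S.γ)
    (hstab : S.Stabilizable) (hdet : RobustMF.ExactlyDetectable S.A S.Q S.C)
    (Pstar : Matrix (Fin n) (Fin n) ℝ) (hPstar : S.IsGameSolution Pstar)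
    (ρ : ℝ) (hρ : 0 < ρ) :
    ∃ α : ℝ, 0 < α ∧ α < 1 ∧
      ∀ (P : ℕ → Matrix (Fin n) (Fin n) ℝ) (L : ℕ → Matrix (Fin m₂) (Fin n) ℝ),
        S.IsOuterLoop P L →
        ∀ (k : ℕ), 1 ≤ k →
        ∀ (Kin : ℕ → Matrix (Fin m₁) (Fin n) ℝ) (Pin : ℕ → Matrix (Fin n) (Fin n) ℝ),
          S.IsInnerLoop (L (k - 1)) Kin Pin →
          (∀ j : ℕ, 1 ≤ j → Kin (j - 1) ∈ S.sublevel Pstar ρ (L (k - 1)) →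
            (Pin (j + 1) - P k).trace ≤ α * (Pin j - P k).trace) ∧
          (Kin 0 ∈ S.sublevel Pstar ρ (L (k - 1)) →
            ∀ j : ℕ, 1 ≤ j → (Pin j - P k).PosSemidef ∧
              (Pin j - P k).trace ≤ α ^ (j - 1) * (Pin 1 - P k).trace) := by
  -- The rate is extracted from one outer loop and transferred to all by uniqueness; if there is
  -- none, any rate will do.
  by_cases hex : ∃ P₀ L₀, S.IsOuterLoop P₀ L₀
  swap
  · exact ⟨1 / 2, by norm_num, by norm_num, fun P L h => absurd ⟨P, L, h⟩ hex⟩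
  obtain ⟨P₀, L₀, h₀⟩ := hex
  obtain ⟨α, hα0, hα1, hα⟩ := h₀.exists_rate hQ hR hγ hPstar ρ hρ
  refine ⟨α, hα0, hα1, fun P L h k hk Kin Pin hin => ?_⟩
  obtain ⟨k, rfl⟩ : ∃ l, k = l + 1 := ⟨k - 1, (Nat.sub_add_cancel hk).symm⟩
  rw [Nat.add_sub_cancel] at hin ⊢
  have hP : P (k + 1) = P₀ (k + 1) := h.unique hR hγ h₀ _
  have hL : L k = L₀ k := by rw [h.gain, h₀.gain, h.unique hR hγ h₀]
  have heval : ∀ j, S.LyapEq (Kin j) (L k) (Pin (j + 1)) := fun j =>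
    hin.evaluation (j + 1) (Nat.succ_pos j)
  have himp : ∀ j, Kin (j + 1) = S.gainK (Pin (j + 1)) := fun j =>
    hin.improvement (j + 1) (Nat.succ_pos j)
  have hstep : ∀ j, S.LStable (Kin j) (L k) → (Pin (j + 1) - P (k + 1)).trace ≤ ρ →
      (Pin (j + 2) - P (k + 1)).trace ≤ α * (Pin (j + 1) - P (k + 1)).trace := by
    intro j hK hρj
    have h1 := heval j
    have h2 := heval (j + 1)
    rw [himp] at h2
    rw [hL] at hK h1 h2
    rw [hP] at hρj ⊢
    exact hα k (Kin j) _ _ hK h1 h2 hρj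
  have hsub : ∀ j, Kin j ∈ S.sublevel Pstar ρ (L k) →
      S.LStable (Kin j) (L k) ∧ (Pin (j + 1) - P (k + 1)).trace ≤ ρ := by
    rintro j ⟨hK, PL, PK, hPL, -, hPK, htr⟩
    have hst : S.LStable (Kin j) (L k) := RobustMF.Data.Stable.lStable hK
    refine ⟨hst, ?_⟩
    rwa [(h.step k).unique hR hγ hPL, (heval j).unique hst hPK]
  refine ⟨fun j hj hmem => ?_, fun hmem j hj => ?_⟩
  · obtain ⟨j, rfl⟩ : ∃ l, j = l + 1 := ⟨j - 1, (Nat.sub_add_cancel hj).symm⟩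
    rw [Nat.add_sub_cancel] at hmem
    exact hstep j (hsub j hmem).1 (hsub j hmem).2
  · obtain ⟨j, rfl⟩ : ∃ l, j = l + 1 := ⟨j - 1, (Nat.sub_add_cancel hj).symm⟩
    rw [Nat.add_sub_cancel]
    -- The induction carries stability and the trace bound, which are all that the contraction step
    -- needs from the sublevel set.
    have key : ∀ j, S.LStable (Kin j) (L k) ∧ (Pin (j + 1) - P (k + 1)).PosSemidef ∧
        (Pin (j + 1) - P (k + 1)).trace ≤ ρ ∧
        (Pin (j + 1) - P (k + 1)).trace ≤ α ^ j * (Pin 1 - P (k + 1)).trace := by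
      intro j
      induction j with
      | zero =>
        obtain ⟨hst, htr⟩ := hsub 0 hmem
        exact ⟨hst, (h.step k).posSemidef_sub hR hγ hst (heval 0), htr, by simp⟩
      | succ j ih =>
        obtain ⟨hst, hpsd, hρj, htr⟩ := ih
        have hst' : S.LStable (Kin (j + 1)) (L k) := by
          rw [himp]
          exact (h.step k).lStable_gainK hR hγ hst (heval j)
        have hs := hstep j hst hρj
        refine ⟨hst', (h.step k).posSemidef_sub hR hγ hst' (heval (j + 1)), ?_, ?_⟩
        · refine hs.trans (le_trans ?_ hρj)
          exact mul_le_of_le_one_left hpsd.trace_nonneg hα1.le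
        · refine hs.trans ((mul_le_mul_of_nonneg_left htr hα0.le).trans (le_of_eq ?_))
          rw [pow_succ]; ring
    exact ⟨(key j).2.1, (key j).2.2.2⟩
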